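/- \textbf{Lemma (Vanishing covariance).} Let $W\subset\mathbb{R}^3$ be a closed ball of volume one. For $t>0$ let $\eta_t$ be a Poisson point process on $W$ with intensity measure $t\lambda_3|_W$ ($\lambda_3$ being Lebesgue measure), regarded as a random set of points, and let $r_t>0$ be connectivity radii in the sparse regime $t r_t^3\to 0$ as $t\to\infty$. Let $e_1,e_2,e_3$ be the standard basis of $\mathbb{R}^3$ and $L=\operatorname{span}\{e_1,e_2\}$. To each $x\in\mathbb{S}^2$ associate a rotation $\theta(x)\in SO(3)$ with $\theta(x)e_3=x$, and put $L_x=\theta(x)L$ (so $L_x$ is the plane through the origin orthogonal to $x$, whatever the choice of $\theta(x)$). Write $[v,w]|_{L_x}$ for the orthogonal projection of the segment $[v,w]$ onto $L_x$, and let $$\xi_{t,x}(L_x)=\tfrac18\,\#\bigl\{(v_1,v_2,w_1,w_2)\in(\eta_t)^4_{\neq}:\ \|v_1-v_2\|\le r_t,\ \|w_1-w_2\|\le r_t,\ [v_1,v_2]|_{L_x}\cap[w_1,w_2]|_{L_x}\neq\emptyset\bigr\}$$ be the number of crossings in the projection onto $L_x$ of the random geometric graph on $\eta_t$ with connectivity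 radius $r_t$, where $(\eta_t)^4_{\neq}$ is the set of $4$-tuples of pairwise distinct points of $\eta_t$. Let $\mathbb{S}^2_{++}=\{x\in\mathbb{S}^2: x_1,x_2,x_3>0\}$, let $d_{\mathbb{S}}$ be the spherical (geodesic) distance, and let $\alpha>0$. Then there are quantities $c_{t,\alpha}=c^{(1)}_{t,\alpha}+c^{(2)}_{t,\alpha}$, not depending on $x$, $y$, with $$c^{(1)}_{t,\alpha}=\mathcal{O}\bigl(t^6r_t^{13}\bigr),\qquad c^{(2)}_{t,\alpha}=\mathcal{O}\bigl(t^{4+3\alpha}r_t^{9}\bigr)\qquad (t\to\infty),$$ such that for all $t>0$ and all $x,y\in\mathbb{S}^2_{++}$ with $d_{\mathbb{S}}(x,y)>t^{-\alpha}$, the variables $\xi_{t,x}(L_x)$ and $\xi_{t,y}(L_y)$ have finite second moments and $$\operatorname{Cov}\bigl(\xi_{t,x}(L_x),\xi_{t,y}(L_y)\bigr)<c_{t,\alpha}.$$ -/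

import Mathlib

open MeasureTheory ProbabilityTheory Filter Topology Asymptotics

noncomputable section

/-- Three-dimensional Euclidean space. -/
abbrev E3 : Type := EuclideanSpace ℝ (Fin 3)

/-- The unit sphere `S²` in three-dimensional Euclidean space. -/
abbrev Sphere2 : Type := Metric.sphere (0 : E3) 1

/-- `η` is a Poisson point process with (finite, diffuse) intensity measure `Λ`. Such a process is
simple, so it is given as the random set of its points: the number of points in a Borel set `B` is
Poisson distributed with mean `Λ B`, and the numbers of points in disjoint Borel sets are
independent. -/
structure IsPoissonProcess {Ω : Type*} [MeasurableSpace Ω] (P : Measure Ω)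
    {E : Type*} [MeasurableSpace E] (Λ : Measure E) (η : Ω → Set E) : Prop where
  measurable_count : ∀ B : Set E, MeasurableSet B → Measurable fun ω => (η ω ∩ B).encard
  hasLaw_count : ∀ B : Set E, MeasurableSet B → Λ B ≠ ⊤ →
    HasLaw (fun ω => (η ω ∩ B).encard)
      ((poissonMeasure (Λ B).toNNReal).map (Nat.cast : ℕ → ℕ∞)) P
  indep_count : ∀ (n : ℕ) (B : Fin n → Set E), (∀ i, MeasurableSet (B i)) →
    Pairwise (fun i j => Disjoint (B i) (B j)) →
    iIndepFun (fun i ω => (η ω ∩ B i).encard) P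

/-- The open positive octant `S²₊₊` of the sphere. -/
def spherePos : Set Sphere2 := {x | ∀ i, 0 < (x : E3) i}

/-- The spherical (geodesic) distance on `S²`. -/
def dSphere (x y : Sphere2) : ℝ := InnerProductGeometry.angle (x : E3) (y : E3)

/-- The reference plane spanned by the first two standard basis vectors. -/
def refPlane : Submodule ℝ E3 :=
  Submodule.span ℝ {EuclideanSpace.single (0 : Fin 3) (1 : ℝ), EuclideanSpace.single 1 1}

/-- The image of a vector under a rotation. -/
def rotate (R : Matrix.specialOrthogonalGroup (Fin 3) ℝ) : E3 →ₗ[ℝ] E3 :=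
  Matrix.toEuclideanLin (R : Matrix (Fin 3) (Fin 3) ℝ)

/-- The plane `L_x = θ(x) L` associated with `x`. -/
def plane (θ : Sphere2 → Matrix.specialOrthogonalGroup (Fin 3) ℝ) (x : Sphere2) :
    Submodule ℝ E3 :=
  refPlane.map (rotate (θ x))

/-- The orthogonal projection `[v, w]|_L` of the segment `[v, w]` onto `L`. -/
def projSegment (L : Submodule ℝ E3) (v w : E3) : Set E3 :=
  L.starProjection '' segment ℝ v w

/-- The intersection of the projections of the edges `{p 0, p 1}` and `{p 2, p 3}`. -/
def crossing (L : Submodule ℝ E3) (p : Fin 4 → E3) : Set E3 :=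
  projSegment L (p 0) (p 1) ∩ projSegment L (p 2) (p 3)

/-- The 4-tuples of distinct vertices in `V` which form two edges of the geometric graph with
connectivity radius `r` whose projections onto `L` meet. -/
def crossingTuples (V : Set E3) (r : ℝ) (L : Submodule ℝ E3) : Set (Fin 4 → E3) :=
  {p | Function.Injective p ∧ (∀ i, p i ∈ V) ∧ ‖p 0 - p 1‖ ≤ r ∧ ‖p 2 - p 3‖ ≤ r ∧
    (crossing L p).Nonempty}

/-- The number of crossings `ξ(A)` in a set `A ⊆ L`: one eighth of the number of crossing tuples
whose crossing lies in `A`. -/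
def crossingCount (V : Set E3) (r : ℝ) (L : Submodule ℝ E3) (A : Set E3) : ℝ :=
  (1 / 8 : ℝ) * ({p ∈ crossingTuples V r L | crossing L p ⊆ A}.ncard : ℝ)

end

/-!
The product of the numbers of tuples of distinct points in `A` and in `B` is a sum over the ways in
which a tuple in `A` can share points with a tuple in `B`, and the mean number of tuples of distinct
points in a measurable set is its measure under a power of the intensity. The pairs without a common
point contribute exactly the product of the means, so the covariance is at most the contribution of
the remaining pairs.

Such a contribution is bounded by integrating out one point after the other: two ends of an edge
differ by an element of a ball of radius `r`, and two points of crossing edges differ by an element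
of the tube of radius `2 * r` around the direction of projection, so that the points are linked to
a single one by a forest. With one or two common points this yields `O(t ^ 6 * r ^ 13)`. With three
or four common points, both edges of the first pair have an end in common with the second pair, and
so the difference of the points `0` and `2` lies in the tubes around both directions of projection.
These meet in a set of volume of order `r ^ 3 / sin (angle x y)`, which yields
`O(t ^ (4 + α) * r ^ 9)` for directions which are at distance `t ^ (-α)` from each other and from
being antipodal.
-/

section DistinctTuples

variable {ι E : Type*}

/-- The families of pairwise distinct points of `V` indexed by `ι`, that is `V ^ ι_≠`. -/
def injTuples (ι : Type*) {E : Type*} (V : Set E) : Set (ι → E) :=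
  {p | Function.Injective p ∧ ∀ i, p i ∈ V}

lemma injTuples_finite [Finite ι] {V : Set E} (hV : V.Finite) : (injTuples ι V).Finite :=
  (Set.Finite.pi' fun _ => hV).subset fun _ hp => hp.2

lemma encard_injTuples [Fintype ι] {V : Set E} (hV : V.Finite) :
    (injTuples ι V).encard = (V.encard.toNat.descFactorial (Fintype.card ι) : ℕ) := by
  classical
  have := hV.fintype
  let e : injTuples ι V ≃ (ι ↪ V) :=
    { toFun := fun p => ⟨fun i => ⟨p.1 i, p.2.2 i⟩, fun i j h => p.2.1 (Subtype.ext_iff.1 h)⟩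
      invFun := fun f => ⟨fun i => f i, fun i j h => f.injective (Subtype.ext h), fun i => (f i).2⟩
      left_inv := fun _ => rfl
      right_inv := fun _ => rfl }
  rw [Set.encard, ENat.card_congr e, ENat.card_eq_coe_fintype_card, Fintype.card_embedding_eq,
    Set.encard, ENat.card_eq_coe_fintype_card]
  rfl

lemma encard_univ_pi_inter_injTuples [Fintype ι] {V : Set E} (hV : V.Finite) {B : ι → Set E}
    (hB : Pairwise fun i j => Disjoint (B i) (B j)) :
    ((Set.univ.pi B ∩ injTuples ι V).encard : ENNReal) =
      ∏ i, ((V ∩ B i).encard : ENNReal) := by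
  classical
  have hf : ∀ i, (V ∩ B i).Finite := fun i => hV.inter_of_left _
  have hset : Set.univ.pi B ∩ injTuples ι V =
      (Fintype.piFinset fun i => (hf i).toFinset : Finset (ι → E)) := by
    ext p
    simp only [injTuples, Set.mem_inter_iff, Set.mem_univ_pi, Set.mem_ofPred_eq, Finset.mem_coe,
      Fintype.mem_piFinset, Set.Finite.mem_toFinset]
    refine ⟨fun h i => ⟨h.2.2 i, h.1 i⟩, fun h => ⟨fun i => (h i).2, ?_, fun i => (h i).1⟩⟩
    intro i j hij
    by_contra hne
    exact Set.disjoint_left.1 (hB hne) (h i).2 (hij ▸ (h j).2)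
  rw [hset, Set.encard_coe_eq_coe_finsetCard, Fintype.card_piFinset]
  simp only [(hf _).encard_eq_coe_toFinset_card, ENat.toENNReal_coe]
  exact Nat.cast_prod _ _

lemma setOf_not_injective :
    {p : ι → E | ¬ Function.Injective p} = ⋃ (i) (j) (_ : i ≠ j), {p | p i = p j} := by
  ext p
  simp only [Function.Injective, Set.mem_ofPred_eq, Set.mem_iUnion]
  grind

lemma exists_disjoint_basis_box [Finite ι] [TopologicalSpace E] [T2Space E]
    {b : Set (Set E)} (hb : TopologicalSpace.IsTopologicalBasis b)
    {U : Set (ι → E)} (hU : IsOpen U) {p : ι → E} (hpU : p ∈ U) (hp : Function.Injective p) :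
    ∃ B : ι → b, Pairwise (fun i j => Disjoint (B i : Set E) (B j)) ∧
      (Set.univ.pi fun i => (B i : Set E)) ⊆ U ∧ p ∈ Set.univ.pi fun i => (B i : Set E) := by
  obtain ⟨V, hV, hdisj⟩ := (Set.finite_range p).t2_separation
  obtain ⟨u, hu, huU⟩ := isOpen_pi_iff'.1 hU p hpU
  choose B hB hpB hBu using fun i => hb.exists_subset_of_mem_open
    (show p i ∈ u i ∩ V (p i) from ⟨(hu i).2, (hV _).1⟩) ((hu i).1.inter (hV _).2)
  refine ⟨fun i => ⟨B i, hB i⟩, fun i j hij => ?_, fun q hq => huU fun i _ => ?_, fun i _ => hpB i⟩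
  · exact (hdisj ⟨i, rfl⟩ ⟨j, rfl⟩ (hp.ne hij)).mono
      ((hBu i).trans Set.inter_subset_right) ((hBu j).trans Set.inter_subset_right)
  · exact (hBu i (hq i trivial)).1

end DistinctTuples

section OffDiagonal

variable {ι E : Type*} [MeasurableSpace E]

/-- A generating π-system of the product σ-algebra on which the counting measures of distinct
tuples are explicit: the measurable sets of non-injective families, and the rectangles with
pairwise disjoint sides. -/
def offDiagSystem (ι E : Type*) [MeasurableSpace E] : Set (Set (ι → E)) :=
  {A | MeasurableSet A ∧ ∀ p ∈ A, ¬ Function.Injective p} ∪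
  {A | ∃ B : ι → Set E, (∀ i, MeasurableSet (B i)) ∧
    Pairwise (fun i j => Disjoint (B i) (B j)) ∧ A = Set.univ.pi B}

lemma measurableSet_of_mem_offDiagSystem [Countable ι] {A : Set (ι → E)}
    (hA : A ∈ offDiagSystem ι E) : MeasurableSet A := by
  rcases hA with hA | ⟨B, hB, -, rfl⟩
  · exact hA.1
  · exact MeasurableSet.univ_pi hB

lemma isPiSystem_offDiagSystem [Countable ι] : IsPiSystem (offDiagSystem ι E) := by
  intro A hA A' hA' _
  have hm := (measurableSet_of_mem_offDiagSystem hA).inter (measurableSet_of_mem_offDiagSystem hA')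
  rcases hA with hA | ⟨B, hB, hd, rfl⟩
  · exact Or.inl ⟨hm, fun p hp => hA.2 p hp.1⟩
  rcases hA' with hA' | ⟨B', hB', -, rfl⟩
  · exact Or.inl ⟨hm, fun p hp => hA'.2 p hp.2⟩
  refine Or.inr ⟨fun i => B i ∩ B' i, fun i => (hB i).inter (hB' i), fun i j hij => ?_, ?_⟩
  · exact (hd hij).mono Set.inter_subset_left Set.inter_subset_left
  · exact Set.pi_inter_distrib.symm

variable [TopologicalSpace E] [SecondCountableTopology E] [T2Space E] [BorelSpace E]

lemma measurableSet_apply_eq_apply [Finite ι] (i j : ι) :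
    MeasurableSet {p : ι → E | p i = p j} :=
  (isClosed_eq (continuous_apply i) (continuous_apply j)).measurableSet

lemma measurableSet_not_injective [Finite ι] :
    MeasurableSet {p : ι → E | ¬ Function.Injective p} := by
  rw [setOf_not_injective]
  exact .iUnion fun i => .iUnion fun j => .iUnion fun _ => measurableSet_apply_eq_apply i j

lemma exists_countable_sUnion_offDiagSystem_eq [Finite ι] {U : Set (ι → E)} (hU : IsOpen U) :
    ∃ T : Set (Set (ι → E)), T.Countable ∧ T ⊆ offDiagSystem ι E ∧ ⋃₀ T = U := by
  let b := TopologicalSpace.countableBasis E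
  have hb : TopologicalSpace.IsTopologicalBasis b := TopologicalSpace.isBasis_countableBasis E
  have : Countable b := (TopologicalSpace.countable_countableBasis E).to_subtype
  let T : Set (Set (ι → E)) := (fun B : ι → b => Set.univ.pi fun i => (B i : Set E)) ''
    {B | Pairwise (fun i j => Disjoint (B i : Set E) (B j)) ∧
      (Set.univ.pi fun i => (B i : Set E)) ⊆ U}
  refine ⟨insert (U ∩ {p | ¬ Function.Injective p}) T,
    ((Set.to_countable _).image _).insert _, ?_, Set.Subset.antisymm ?_ fun p hpU => ?_⟩
  · rintro A (rfl | ⟨B, hB, rfl⟩)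
    · exact Or.inl ⟨hU.measurableSet.inter measurableSet_not_injective, fun p hp => hp.2⟩
    · exact Or.inr ⟨fun i => B i, fun i => (hb.isOpen (B i).2).measurableSet, hB.1, rfl⟩
  · refine Set.sUnion_subset ?_
    rintro A (rfl | ⟨B, hB, rfl⟩)
    exacts [Set.inter_subset_left, hB.2]
  · by_cases hp : Function.Injective p
    · obtain ⟨B, hdisj, hBU, hpB⟩ := exists_disjoint_basis_box hb hU hpU hp
      exact ⟨_, Or.inr ⟨B, ⟨hdisj, hBU⟩, rfl⟩, hpB⟩
    · exact ⟨_, Or.inl rfl, hpU, hp⟩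

lemma generateFrom_offDiagSystem [Finite ι] :
    (MeasurableSpace.pi : MeasurableSpace (ι → E)) =
      MeasurableSpace.generateFrom (offDiagSystem ι E) := by
  refine le_antisymm ?_ (MeasurableSpace.generateFrom_le
    fun A hA => measurableSet_of_mem_offDiagSystem hA)
  rw [BorelSpace.measurable_eq (α := ι → E)]
  refine MeasurableSpace.generateFrom_le fun U hU => ?_
  obtain ⟨T, hT, hTs, rfl⟩ := exists_countable_sUnion_offDiagSystem_eq hU
  exact MeasurableSet.sUnion hT fun A hA => MeasurableSpace.measurableSet_generateFrom (hTs hA)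

lemma pi_apply_eq_apply [Fintype ι] (Λ : Measure E) [SigmaFinite Λ] [NullSingletonClass Λ]
    {i j : ι} (hij : i ≠ j) : Measure.pi (fun _ : ι => Λ) {p | p i = p j} = 0 := by
  classical
  rcases isEmpty_or_nonempty (ι → E) with _ | ⟨⟨p₀⟩⟩
  · simp [Set.eq_empty_of_isEmpty]
  have hm : MeasurableSet {p : ι → E | p i = p j} := measurableSet_apply_eq_apply i j
  have hslice (p : ι → E) : ∫⁻ y, {p : ι → E | p i = p j}.indicator 1
      (Function.update p i y) ∂Λ = 0 := by
    have hind : (fun y => {p : ι → E | p i = p j}.indicator (1 : (ι → E) → ENNReal)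
        (Function.update p i y)) = ({p j} : Set E).indicator 1 := by
      ext y
      simp [Set.indicator, Function.update_of_ne hij.symm]
    rw [hind, lintegral_indicator_one (measurableSet_singleton _), measure_singleton]
  rw [← lintegral_indicator_one hm, lintegral_eq_lmarginal_univ (μ := fun _ => Λ) p₀,
    lmarginal_erase' _ (measurable_one.indicator hm) (Finset.mem_univ i)]
  simp [hslice, lmarginal]

lemma pi_not_injective [Fintype ι] (Λ : Measure E) [SigmaFinite Λ] [NullSingletonClass Λ] :
    Measure.pi (fun _ : ι => Λ) {p | ¬ Function.Injective p} = 0 := by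
  simp only [setOf_not_injective, measure_iUnion_null_iff]
  exact fun i j hij => pi_apply_eq_apply Λ hij

end OffDiagonal

section FactorialMoments

variable {ι E Ω : Type*}

lemma lintegral_natCast_poissonMeasure (a : NNReal) :
    ∫⁻ n : ℕ, (n : ENNReal) ∂poissonMeasure a = a := by
  have hshift (n : ℕ) : ENNReal.ofReal (Real.exp (-a) * a ^ (n + 1) / (n + 1).factorial) *
      ((n + 1 : ℕ) : ENNReal) = a * ENNReal.ofReal (Real.exp (-a) * a ^ n / n.factorial) := by
    rw [← ENNReal.ofReal_natCast (n + 1), ← ENNReal.ofReal_coe_nnreal (p := a),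
      ← ENNReal.ofReal_mul (by positivity), ← ENNReal.ofReal_mul (by positivity),
      Nat.factorial_succ]
    congr 1
    push_cast
    field_simp
    ring
  have htotal : ∑' n : ℕ, ENNReal.ofReal (Real.exp (-a) * a ^ n / n.factorial) = 1 := by
    simpa [poissonMeasure, Measure.sum_apply] using measure_univ (μ := poissonMeasure a)
  simp only [poissonMeasure, lintegral_sum_measure, lintegral_smul_measure, lintegral_dirac,
    smul_eq_mul]
  rw [tsum_eq_zero_add' ENNReal.summable]
  simp [hshift, ENNReal.tsum_mul_left, htotal, -Nat.cast_add]

namespace IsPoissonProcess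

variable [MeasurableSpace Ω] [MeasurableSpace E] {P : Measure Ω} {Λ : Measure E} {η : Ω → Set E}

lemma measurable_count_toENNReal (h : IsPoissonProcess P Λ η) {B : Set E} (hB : MeasurableSet B) :
    Measurable fun ω => ((η ω ∩ B).encard : ENNReal) :=
  (measurable_from_top (f := ENat.toENNReal)).comp (h.measurable_count B hB)

lemma lintegral_encard (h : IsPoissonProcess P Λ η) {B : Set E}
    (hB : MeasurableSet B) (hfin : Λ B ≠ ⊤) :
    ∫⁻ ω, ((η ω ∩ B).encard : ENNReal) ∂P = Λ B := by
  rw [(h.hasLaw_count B hB hfin).lintegral_comp (f := ENat.toENNReal)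
    measurable_from_top.aemeasurable, lintegral_map measurable_from_top measurable_from_top]
  simp [lintegral_natCast_poissonMeasure, ENNReal.coe_toNNReal hfin]

lemma iIndepFun_count [Finite ι] (h : IsPoissonProcess P Λ η) {B : ι → Set E}
    (hB : ∀ i, MeasurableSet (B i)) (hd : Pairwise fun i j => Disjoint (B i) (B j)) :
    iIndepFun (fun i ω => (η ω ∩ B i).encard) P := by
  let e := Finite.equivFin ι
  have hfin := h.indep_count _ (fun k => B (e.symm k)) (fun k => hB _)
    (fun k l hkl => hd (e.symm.injective.ne hkl))
  simpa using hfin.precomp (g := e) e.injective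

lemma measurableSet_finite (h : IsPoissonProcess P Λ η) : MeasurableSet {ω | (η ω).Finite} := by
  have hpre : {ω | (η ω).Finite} = (fun ω => (η ω ∩ Set.univ).encard) ⁻¹' {⊤}ᶜ := by
    ext ω; simp
  rw [hpre]
  exact h.measurable_count _ .univ (measurableSet_singleton _).compl

lemma ae_finite [IsFiniteMeasure Λ] (h : IsPoissonProcess P Λ η) : ∀ᵐ ω ∂P, (η ω).Finite := by
  have hmean : ∫⁻ ω, ((η ω ∩ Set.univ).encard : ENNReal) ∂P ≠ ⊤ := by
    rw [h.lintegral_encard .univ (measure_ne_top Λ _)]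
    exact measure_ne_top Λ _
  filter_upwards [ae_lt_top (h.measurable_count_toENNReal .univ) hmean] with ω hω
  rw [← Set.encard_lt_top_iff]
  simpa using hω

lemma exists_finite [IsFiniteMeasure Λ] (h : IsPoissonProcess P Λ η) :
    ∃ η' : Ω → Set E, IsPoissonProcess P Λ η' ∧ (∀ ω, (η' ω).Finite) ∧ η' =ᵐ[P] η := by
  classical
  let η' : Ω → Set E := fun ω => if (η ω).Finite then η ω else ∅
  have hη' : η' =ᵐ[P] η := by
    filter_upwards [h.ae_finite] with ω hω
    exact if_pos hω
  have hcount (B : Set E) : (fun ω => (η' ω ∩ B).encard) =ᵐ[P] fun ω => (η ω ∩ B).encard := by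
    filter_upwards [hη'] with ω hω
    rw [hω]
  have hite (B : Set E) : (fun ω => (η' ω ∩ B).encard) =
      fun ω => if (η ω).Finite then (η ω ∩ B).encard else 0 := by
    ext ω
    by_cases hω : (η ω).Finite <;> simp [η', hω]
  refine ⟨η', ⟨fun B hB => ?_, fun B hB hB' => (h.hasLaw_count B hB hB').congr (hcount B),
    fun n B hB hd => (iIndepFun_congr fun i => hcount (B i)).2 (h.indep_count n B hB hd)⟩,
    fun ω => ?_, hη'⟩
  · rw [hite]
    exact (h.measurable_count B hB).ite h.measurableSet_finite measurable_const
  · by_cases hω : (η ω).Finite <;> simp [η', hω]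

end IsPoissonProcess

/-- The counting measure on the families of pairwise distinct points of `V`; for a point process
`V`, its expectation is the factorial moment measure. -/
noncomputable def tupleMeasure (ι : Type*) [MeasurableSpace E] (V : Set E) : Measure (ι → E) :=
  Measure.count.restrict (injTuples ι V)

variable [MeasurableSpace Ω] [MeasurableSpace E] {P : Measure Ω} {Λ : Measure E} {η : Ω → Set E}
  [TopologicalSpace E] [SecondCountableTopology E] [T2Space E] [BorelSpace E]

lemma tupleMeasure_apply [Finite ι] {V : Set E} (hV : V.Finite) {A : Set (ι → E)}
    (hA : MeasurableSet A) : tupleMeasure ι V A = ((A ∩ injTuples ι V).encard : ENNReal) := by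
  rw [tupleMeasure, Measure.restrict_apply hA,
    Measure.count_apply (hA.inter (injTuples_finite hV).measurableSet)]

lemma tupleMeasure_univ [Fintype ι] {V : Set E} (hV : V.Finite) :
    tupleMeasure ι V .univ = (V.encard.toNat.descFactorial (Fintype.card ι) : ℕ) := by
  rw [tupleMeasure_apply hV .univ, Set.univ_inter, encard_injTuples hV, ENat.toENNReal_coe]

lemma tupleMeasure_eq_zero [Finite ι] {V : Set E} (hV : V.Finite) {A : Set (ι → E)}
    (hA : MeasurableSet A) (hinj : ∀ p ∈ A, ¬ Function.Injective p) : tupleMeasure ι V A = 0 := by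
  have hempty : A ∩ injTuples ι V = ∅ :=
    Set.eq_empty_of_forall_notMem fun p hp => hinj p hp.1 hp.2.1
  simp [tupleMeasure_apply hV hA, hempty]

lemma tupleMeasure_univ_pi [Fintype ι] {V : Set E} (hV : V.Finite) {B : ι → Set E}
    (hB : ∀ i, MeasurableSet (B i)) (hd : Pairwise fun i j => Disjoint (B i) (B j)) :
    tupleMeasure ι V (Set.univ.pi B) = ∏ i, ((V ∩ B i).encard : ENNReal) := by
  rw [tupleMeasure_apply hV (.univ_pi hB), encard_univ_pi_inter_injTuples hV hd]

namespace IsPoissonProcess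

lemma measurable_tupleMeasure [Finite ι] (h : IsPoissonProcess P Λ η) (hη : ∀ ω, (η ω).Finite) :
    Measurable fun ω => tupleMeasure ι (η ω) := by
  have := Fintype.ofFinite ι
  have (ω : Ω) : IsFiniteMeasure (tupleMeasure ι (η ω)) :=
    ⟨by rw [tupleMeasure_univ (hη ω)]; exact ENNReal.natCast_lt_top _⟩
  refine Measurable.measure_of_isPiSystem generateFrom_offDiagSystem isPiSystem_offDiagSystem ?_ ?_
  · rintro A (⟨hA, hinj⟩ | ⟨B, hB, hd, rfl⟩)
    · simp only [tupleMeasure_eq_zero (hη _) hA hinj, measurable_const]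
    · simp only [tupleMeasure_univ_pi (hη _) hB hd]
      exact Finset.measurable_fun_prod _ fun i _ => h.measurable_count_toENNReal (hB i)
  · have huniv := (measurable_from_top (f := fun n : ℕ∞ =>
      ((n.toNat.descFactorial (Fintype.card ι) : ℕ) : ENNReal))).comp (h.measurable_count _ .univ)
    simpa only [tupleMeasure_univ (hη _), Set.inter_univ, Function.comp_def] using huniv

theorem lintegral_tupleMeasure [Fintype ι] [IsFiniteMeasure Λ] [NullSingletonClass Λ]
    (h : IsPoissonProcess P Λ η) (hη : ∀ ω, (η ω).Finite) {A : Set (ι → E)}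
    (hA : MeasurableSet A) :
    ∫⁻ ω, tupleMeasure ι (η ω) A ∂P = Measure.pi (fun _ : ι => Λ) A := by
  have hmeas := (h.measurable_tupleMeasure (ι := ι) hη).aemeasurable (μ := P)
  rw [← Measure.bind_apply hA hmeas]
  suffices hbind : Measure.pi (fun _ : ι => Λ) = P.bind fun ω => tupleMeasure ι (η ω) by rw [hbind]
  obtain ⟨T, hTc, hTs, hTU⟩ :=
    exists_countable_sUnion_offDiagSystem_eq (ι := ι) (E := E) isOpen_univ
  refine Measure.ext_of_generateFrom_of_cover_subset generateFrom_offDiagSystem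
    isPiSystem_offDiagSystem hTs hTc hTU (fun _ _ => measure_ne_top _ _) fun A hA => ?_
  rw [Measure.bind_apply (measurableSet_of_mem_offDiagSystem hA) hmeas]
  rcases hA with ⟨hA, hinj⟩ | ⟨B, hB, hd, rfl⟩
  · simp only [tupleMeasure_eq_zero (hη _) hA hinj, lintegral_zero]
    exact measure_mono_null hinj (pi_not_injective Λ)
  · have hindep := (h.iIndepFun_count hB hd).comp (fun _ => ENat.toENNReal)
      fun _ => measurable_from_top
    simp only [tupleMeasure_univ_pi (hη _) hB hd, Measure.pi_pi]
    rw [lintegral_prod_eq_prod_lintegral_of_indepFun Finset.univ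
      (fun i ω => ((η ω ∩ B i).encard : ENNReal)) hindep
      fun i => h.measurable_count_toENNReal (hB i)]
    exact Finset.prod_congr rfl fun i _ => (h.lintegral_encard (hB i) (measure_ne_top _ _)).symm

end IsPoissonProcess

end FactorialMoments

section Overlaps

variable {ι E Ω : Type*} [Fintype ι]

/-- The ways in which a family `q` of distinct points can share points with a family `p` of distinct
points: `f j = some i` means `q j = p i`, and `f j = none` means that `q j` does not occur in
`p`. -/
def overlapPatterns (ι : Type*) [Fintype ι] [DecidableEq ι] : Finset (ι → Option ι) :=
  {f | ∀ i j a, f i = some a → f j = some a → i = j}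

/-- The indices of the points of the second family which do not occur in the first one. -/
def freshIndices (f : ι → Option ι) : Finset ι := {j | f j = none}

lemma card_freshIndices_lt {f : ι → Option ι} (hf : f ≠ fun _ => none) :
    (freshIndices f).card < Fintype.card ι := by
  obtain ⟨j, hj⟩ := Function.ne_iff.1 hf
  exact Finset.card_lt_univ_of_notMem (x := j) (by simpa [freshIndices] using hj)

variable [DecidableEq ι]

/-- The family `q` which overlaps with `p` in the pattern `f` and has the fresh points `u`. -/
def glue (f : ι → Option ι) (p : ι → E) (u : freshIndices f → E) : ι → E :=
  Function.updateFinset (fun j => p ((f j).getD j)) (freshIndices f) u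

/-- The families `p` in `A` together with fresh points which complete them to a pair of a family in
`A` and a family in `B` overlapping in the pattern `f`. -/
def overlapSet (f : ι → Option ι) (A B : Set (ι → E)) : Set (ι ⊕ freshIndices f → E) :=
  {s | s ∘ .inl ∈ A ∧ glue f (s ∘ .inl) (s ∘ .inr) ∈ B}

lemma glue_of_eq_some {f : ι → Option ι} {j i : ι} (h : f j = some i) (p : ι → E)
    (u : freshIndices f → E) : glue f p u j = p i := by
  simp [glue, Function.updateFinset, freshIndices, h]

lemma glue_coe (f : ι → Option ι) (p : ι → E) (u : freshIndices f → E) (k : freshIndices f) :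
    glue f p u k = u k := by
  simp [glue, Function.updateFinset]

lemma prod_injTuples_subset_biUnion (V : Set E) (A B : Set (ι → E)) :
    (A ∩ injTuples ι V) ×ˢ (B ∩ injTuples ι V) ⊆
      ⋃ f ∈ overlapPatterns ι, (fun s => (s ∘ .inl, glue f (s ∘ .inl) (s ∘ .inr))) ''
        (overlapSet f A B ∩ injTuples (ι ⊕ freshIndices f) V) := by
  classical
  rintro ⟨p, q⟩ ⟨⟨hpA, hp, hpV⟩, ⟨hqB, hq, hqV⟩⟩
  let f : ι → Option ι := fun j => if h : ∃ i, p i = q j then some h.choose else none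
  have hsome {j i : ι} (h : f j = some i) : p i = q j := by
    by_cases hj : ∃ i, p i = q j
    · rw [show f j = some hj.choose from dif_pos hj, Option.some.injEq] at h
      exact h ▸ hj.choose_spec
    · simp [f, dif_neg hj] at h
  have hnone {j : ι} (h : f j = none) (i : ι) : p i ≠ q j := by
    rintro hi
    simp [f, show ∃ i, p i = q j from ⟨i, hi⟩] at h
  have hfresh (k : freshIndices f) : f k = none := by simpa [freshIndices] using k.2
  have hglue : glue f p (fun k => q k) = q := by
    ext1 j
    rcases hj : f j with _ | i
    · exact glue_coe f p _ ⟨j, by simp [freshIndices, hj]⟩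
    · rw [glue_of_eq_some hj, hsome hj]
  refine Set.mem_iUnion₂.2 ⟨f, ?_, Sum.elim p fun k => q k, ⟨⟨hpA, ?_⟩, ?_, ?_⟩, ?_⟩
  · simp only [overlapPatterns, Finset.mem_filter, Finset.mem_univ, true_and]
    exact fun i j a hi hj => hq ((hsome hi).symm.trans (hsome hj))
  · exact hglue.symm ▸ hqB
  · exact hp.sumElim (hq.comp Subtype.val_injective) fun i k => hnone (hfresh k) i
  · exact Sum.forall.2 ⟨hpV, fun k => hqV k⟩
  · exact Prod.ext rfl hglue

lemma exists_eq_some_notMem_of_card_lt {f : ι → Option ι} (hf : f ∈ overlapPatterns ι)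
    {e : Finset ι} (he : e.card < (freshIndices f)ᶜ.card) : ∃ i a, f i = some a ∧ a ∉ e := by
  by_contra! hmem
  have hsome {i : ι} (hi : i ∈ (freshIndices f)ᶜ) : ∃ a, f i = some a := by
    simpa [freshIndices, Option.ne_none_iff_exists'] using hi
  refine he.not_ge (Finset.card_le_card_of_injOn (fun i => (f i).getD i) (fun i hi => ?_) ?_)
  · obtain ⟨a, ha⟩ := hsome hi
    simpa [ha] using hmem i a ha
  · intro i hi j hj hij
    obtain ⟨a, ha⟩ := hsome hi
    obtain ⟨b, hb⟩ := hsome hj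
    simp only [ha, hb, Option.getD_some] at hij
    exact (Finset.mem_filter.1 hf).2 i j b (hij ▸ ha) hb

variable [MeasurableSpace Ω] [MeasurableSpace E] {P : Measure Ω} {Λ : Measure E} {η : Ω → Set E}

lemma measurableSet_overlapSet (f : ι → Option ι) {A B : Set (ι → E)}
    (hA : MeasurableSet A) (hB : MeasurableSet B) : MeasurableSet (overlapSet f A B) := by
  refine ((measurable_pi_iff.2 fun _ => measurable_pi_apply _) hA).inter
    ((measurable_pi_iff.2 fun j => ?_) hB)
  by_cases hj : j ∈ freshIndices f
  · simp only [glue, Function.updateFinset, hj, dif_pos]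
    exact measurable_pi_apply _
  · simp only [glue, Function.updateFinset, hj, dif_neg, not_false_eq_true]
    exact measurable_pi_apply _

lemma pi_overlapSet [SigmaFinite Λ] (f : ι → Option ι) {A B : Set (ι → E)}
    (hA : MeasurableSet A) (hB : MeasurableSet B) :
    Measure.pi (fun _ : ι ⊕ freshIndices f => Λ) (overlapSet f A B) =
      ∫⁻ p in A, (∫⋯∫⁻_freshIndices f, B.indicator 1 ∂fun _ => Λ) (fun j => p ((f j).getD j))
        ∂Measure.pi fun _ : ι => Λ := by
  have hm := measurableSet_overlapSet f hA hB
  rw [← (measurePreserving_sumPiEquivProdPi_symm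
      fun _ : ι ⊕ freshIndices f => Λ).measure_preimage hm.nullMeasurableSet,
    Measure.prod_apply ((MeasurableEquiv.measurable _) hm), ← lintegral_indicator hA]
  refine lintegral_congr fun p => ?_
  by_cases hp : p ∈ A
  · have hslice : Prod.mk p ⁻¹' ((MeasurableEquiv.sumPiEquivProdPi
        fun _ : ι ⊕ freshIndices f => E).symm ⁻¹' overlapSet f A B) = glue f p ⁻¹' B :=
      Set.ext fun u => and_iff_right hp
    rw [hslice, Set.indicator_of_mem hp]
    exact (lintegral_indicator_one (measurable_updateFinset hB)).symm
  · have hslice : Prod.mk p ⁻¹' ((MeasurableEquiv.sumPiEquivProdPi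
        fun _ : ι ⊕ freshIndices f => E).symm ⁻¹' overlapSet f A B) = ∅ :=
      Set.eq_empty_of_forall_notMem fun u h => hp h.1
    rw [hslice, Set.indicator_of_notMem hp, measure_empty]

lemma pi_overlapSet_none [SigmaFinite Λ] {A B : Set (ι → E)} (hA : MeasurableSet A)
    (hB : MeasurableSet B) :
    Measure.pi (fun _ => Λ) (overlapSet (fun _ : ι => none) A B) =
      Measure.pi (fun _ => Λ) A * Measure.pi (fun _ => Λ) B := by
  have hfresh : freshIndices (fun _ : ι => none) = .univ := by simp [freshIndices]
  rw [pi_overlapSet _ hA hB, hfresh]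
  simp [lintegral_indicator_one hB, mul_comm]

lemma pi_overlapSet_le [SigmaFinite Λ] {f : ι → Option ι} {A B : Set (ι → E)}
    (hA : MeasurableSet A) (hB : MeasurableSet B) {C : ENNReal}
    (hC : ∀ q, (∫⋯∫⁻_freshIndices f, B.indicator 1 ∂fun _ => Λ) q ≤ C) :
    Measure.pi (fun _ => Λ) (overlapSet f A B) ≤ C * Measure.pi (fun _ => Λ) A := by
  rw [pi_overlapSet f hA hB]
  exact (lintegral_mono fun p => hC _).trans_eq (setLIntegral_const A C)

variable [TopologicalSpace E] [SecondCountableTopology E] [T2Space E] [BorelSpace E]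

lemma tupleMeasure_mul_le {V : Set E} (hV : V.Finite) {A B : Set (ι → E)}
    (hA : MeasurableSet A) (hB : MeasurableSet B) :
    tupleMeasure ι V A * tupleMeasure ι V B ≤
      ∑ f ∈ overlapPatterns ι, tupleMeasure (ι ⊕ freshIndices f) V (overlapSet f A B) := by
  simp only [tupleMeasure_apply hV hA, tupleMeasure_apply hV hB,
    tupleMeasure_apply hV (measurableSet_overlapSet _ hA hB)]
  rw [← ENat.toENNReal_mul, ← Set.encard_prod]
  simp only [← ENat.toENNRealRingHom_apply, ← map_sum]
  refine ENat.toENNReal_le.2 ?_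
  exact (Set.encard_le_encard (prod_injTuples_subset_biUnion V A B)).trans <|
    ((overlapPatterns ι).set_encard_biUnion_le _).trans <|
    Finset.sum_le_sum fun f _ => Set.encard_image_le _ _

namespace IsPoissonProcess

variable [IsFiniteMeasure Λ] [NullSingletonClass Λ]

lemma lintegral_tupleMeasure_mul_le (h : IsPoissonProcess P Λ η) (hη : ∀ ω, (η ω).Finite)
    {A B : Set (ι → E)} (hA : MeasurableSet A) (hB : MeasurableSet B) :
    ∫⁻ ω, tupleMeasure ι (η ω) A * tupleMeasure ι (η ω) B ∂P ≤
      Measure.pi (fun _ => Λ) A * Measure.pi (fun _ => Λ) B +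
      ∑ f ∈ (overlapPatterns ι).erase fun _ => none,
        Measure.pi (fun _ => Λ) (overlapSet f A B) := by
  refine (lintegral_mono fun ω => tupleMeasure_mul_le (hη ω) hA hB).trans_eq ?_
  have hnone : (fun _ => none) ∈ overlapPatterns ι := by simp [overlapPatterns]
  have hmeas (f : ι → Option ι) :
      Measurable fun ω => tupleMeasure (ι ⊕ freshIndices f) (η ω) (overlapSet f A B) :=
    (Measure.measurable_coe (measurableSet_overlapSet f hA hB)).comp (h.measurable_tupleMeasure hη)
  rw [lintegral_finsetSum' _ fun f _ => (hmeas f).aemeasurable, ← pi_overlapSet_none hA hB,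
    ← Finset.add_sum_erase _ _ hnone]
  simp only [h.lintegral_tupleMeasure hη (measurableSet_overlapSet _ hA hB)]

lemma lintegral_tupleMeasure_mul_ne_top {ι : Type*} [Finite ι] (h : IsPoissonProcess P Λ η)
    (hη : ∀ ω, (η ω).Finite) {A B : Set (ι → E)} (hA : MeasurableSet A)
    (hB : MeasurableSet B) :
    ∫⁻ ω, tupleMeasure ι (η ω) A * tupleMeasure ι (η ω) B ∂P ≠ ⊤ := by
  classical
  have := Fintype.ofFinite ι
  exact ne_top_of_le_ne_top (ENNReal.add_ne_top.2 ⟨ENNReal.mul_ne_top (measure_ne_top _ _)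
    (measure_ne_top _ _), ENNReal.sum_ne_top.2 fun _ _ => measure_ne_top _ _⟩)
    (h.lintegral_tupleMeasure_mul_le hη hA hB)

end IsPoissonProcess

end Overlaps

section Covariance

variable {Ω : Type*} [MeasurableSpace Ω] {P : Measure Ω} {N N' : Ω → ENNReal}

lemma ae_lt_top_of_lintegral_mul_self (hN : Measurable N) (h : ∫⁻ ω, N ω * N ω ∂P ≠ ⊤) :
    ∀ᵐ ω ∂P, N ω < ⊤ := by
  filter_upwards [ae_lt_top (hN.fun_mul hN) h] with ω hω
  by_contra htop
  simp [not_lt_top_iff.1 htop] at hω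

lemma lintegral_ne_top_of_lintegral_mul_self [IsFiniteMeasure P]
    (h : ∫⁻ ω, N ω * N ω ∂P ≠ ⊤) : ∫⁻ ω, N ω ∂P ≠ ⊤ := by
  have hle (ω : Ω) : N ω ≤ 1 + N ω * N ω := by
    rcases le_total (N ω) 1 with h1 | h1
    · exact h1.trans le_self_add
    · exact (le_mul_of_one_le_left' h1).trans le_add_self
  refine ne_top_of_le_ne_top ?_ (lintegral_mono hle)
  rw [lintegral_add_left measurable_const, lintegral_one]
  exact ENNReal.add_ne_top.2 ⟨measure_ne_top _ _, h⟩

lemma memLp_two_toReal (hN : Measurable N) (h : ∫⁻ ω, N ω * N ω ∂P ≠ ⊤) :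
    MemLp (fun ω => (N ω).toReal) 2 P := by
  rw [memLp_two_iff_integrable_sq hN.ennreal_toReal.aestronglyMeasurable]
  simpa only [← sq, ENNReal.toReal_pow] using
    integrable_toReal_of_lintegral_ne_top (hN.fun_mul hN).aemeasurable h

lemma covariance_toReal_le [IsProbabilityMeasure P] (hN : Measurable N) (hN' : Measurable N')
    (h : ∫⁻ ω, N ω * N ω ∂P ≠ ⊤) (h' : ∫⁻ ω, N' ω * N' ω ∂P ≠ ⊤) {β : NNReal}
    (hβ : ∫⁻ ω, N ω * N' ω ∂P ≤ (∫⁻ ω, N ω ∂P) * (∫⁻ ω, N' ω ∂P) + β) :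
    cov[fun ω => (N ω).toReal, fun ω => (N' ω).toReal; P] ≤ β := by
  have hfin := ae_lt_top_of_lintegral_mul_self hN h
  have hfin' := ae_lt_top_of_lintegral_mul_self hN' h'
  have hprod : (∫⁻ ω, N ω ∂P) * ∫⁻ ω, N' ω ∂P ≠ ⊤ := ENNReal.mul_ne_top
    (lintegral_ne_top_of_lintegral_mul_self h) (lintegral_ne_top_of_lintegral_mul_self h')
  have hmul : ∫ ω, (N ω).toReal * (N' ω).toReal ∂P = (∫⁻ ω, N ω * N' ω ∂P).toReal := by
    simp only [← ENNReal.toReal_mul]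
    refine integral_toReal (hN.fun_mul hN').aemeasurable ?_
    filter_upwards [hfin, hfin'] with ω hω hω' using ENNReal.mul_lt_top hω hω'
  have hreal := ENNReal.toReal_mono (ENNReal.add_ne_top.2 ⟨hprod, ENNReal.coe_ne_top⟩) hβ
  rw [ENNReal.toReal_add hprod ENNReal.coe_ne_top, ENNReal.toReal_mul, ENNReal.coe_toReal] at hreal
  rw [covariance_eq_sub (memLp_two_toReal hN h) (memLp_two_toReal hN' h')]
  simp only [Pi.mul_apply, hmul, integral_toReal hN.aemeasurable hfin,
    integral_toReal hN'.aemeasurable hfin']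
  linarith

lemma covariance_congr_ae {X X' Y Y' : Ω → ℝ} (hX : X =ᵐ[P] X') (hY : Y =ᵐ[P] Y') :
    cov[X, Y; P] = cov[X', Y'; P] := by
  simp only [covariance, integral_congr_ae hX, integral_congr_ae hY]
  refine integral_congr_ae ?_
  filter_upwards [hX, hY] with ω h h'
  rw [h, h']

end Covariance

section TupleCounts

variable {ι E Ω : Type*} [MeasurableSpace Ω] [MeasurableSpace E] [TopologicalSpace E]
  [SecondCountableTopology E] [T2Space E] [BorelSpace E] {P : Measure Ω} {Λ : Measure E}
  [IsFiniteMeasure Λ] [NullSingletonClass Λ] {η : Ω → Set E}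

namespace IsPoissonProcess

lemma memLp_tupleMeasure [Finite ι] (h : IsPoissonProcess P Λ η) (hη : ∀ ω, (η ω).Finite)
    {A : Set (ι → E)} (hA : MeasurableSet A) :
    MemLp (fun ω => (tupleMeasure ι (η ω) A).toReal) 2 P :=
  memLp_two_toReal ((Measure.measurable_coe hA).comp (h.measurable_tupleMeasure hη))
    (h.lintegral_tupleMeasure_mul_ne_top hη hA hA)

lemma covariance_tupleMeasure_le [IsProbabilityMeasure P] [Fintype ι] [DecidableEq ι]
    (h : IsPoissonProcess P Λ η) (hη : ∀ ω, (η ω).Finite) {A B : Set (ι → E)}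
    (hA : MeasurableSet A) (hB : MeasurableSet B) {β : NNReal}
    (hβ : ∑ f ∈ (overlapPatterns ι).erase fun _ => none,
      Measure.pi (fun _ => Λ) (overlapSet f A B) ≤ β) :
    cov[fun ω => (tupleMeasure ι (η ω) A).toReal,
      fun ω => (tupleMeasure ι (η ω) B).toReal; P] ≤ β := by
  have hmeas {A : Set (ι → E)} (hA : MeasurableSet A) :
      Measurable fun ω => tupleMeasure ι (η ω) A :=
    (Measure.measurable_coe hA).comp (h.measurable_tupleMeasure hη)
  refine covariance_toReal_le (hmeas hA) (hmeas hB)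
    (h.lintegral_tupleMeasure_mul_ne_top hη hA hA) (h.lintegral_tupleMeasure_mul_ne_top hη hB hB) ?_
  rw [h.lintegral_tupleMeasure hη hA, h.lintegral_tupleMeasure hη hB]
  exact (h.lintegral_tupleMeasure_mul_le hη hA hB).trans (by gcongr)

end IsPoissonProcess

end TupleCounts

section ForestIntegration

variable {ι E : Type*} [MeasurableSpace E]

/-- The Lévy concentration function of `Λ`: the largest measure of a translate of `T`. -/
noncomputable def concentration [Sub E] (Λ : Measure E) (T : Set E) : ENNReal :=
  ⨆ c, Λ {w | w - c ∈ T}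

lemma measure_sub_mem_le_concentration [Sub E] (Λ : Measure E) (T : Set E) (c : E) :
    Λ {w | w - c ∈ T} ≤ concentration Λ T :=
  le_iSup (fun c => Λ {w | w - c ∈ T}) c

/-- The constraint `q tip - q base ∈ window` on families `q : ι → E`, seen as an edge of a graph
on `ι`. -/
structure Link (ι E : Type*) where
  /-- The index of the point which is integrated out. -/
  tip : ι
  /-- The index of the point relative to which the tip is constrained. -/
  base : ι
  /-- The range of the difference of the two points. -/
  window : Set E

/-- The families which satisfy all constraints in `l`. -/
def linkSet [Sub E] (l : List (Link ι E)) : Set (ι → E) :=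
  {q | ∀ e ∈ l, q e.tip - q e.base ∈ e.window}

/-- The links form a forest, listed such that the tip of each link is a leaf of the graph formed by
this link and the later ones. -/
def IsForest : List (Link ι E) → Prop
  | [] => True
  | e :: l => e.tip ≠ e.base ∧ (∀ e' ∈ l, e.tip ≠ e'.tip ∧ e.tip ≠ e'.base) ∧ IsForest l

lemma measurableSet_linkSet [Sub E] [MeasurableSub₂ E] {l : List (Link ι E)}
    (hl : ∀ e ∈ l, MeasurableSet e.window) : MeasurableSet (linkSet l) := by
  have hset : linkSet l = ⋂ e ∈ {e | e ∈ l}, {q | q e.tip - q e.base ∈ e.window} := by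
    ext q
    simp [linkSet]
  rw [hset]
  exact MeasurableSet.biInter l.finite_toSet.countable fun e he =>
    (show Measurable fun q : ι → E => q e.tip - q e.base by fun_prop) (hl e he)

variable [DecidableEq ι] [Sub E] [MeasurableSub₂ E] {Λ : Measure E}

lemma lintegral_linkSet_cons_le {e : Link ι E} {l : List (Link ι E)} (h : IsForest (e :: l))
    (he : MeasurableSet e.window) (q : ι → E) :
    ∫⁻ w, (linkSet (e :: l)).indicator 1 (Function.update q e.tip w) ∂Λ ≤
      concentration Λ e.window * (linkSet l).indicator 1 q := by
  have hupd (w : E) : Function.update q e.tip w ∈ linkSet (e :: l) ↔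
      w - q e.base ∈ e.window ∧ q ∈ linkSet l := by
    simp only [linkSet, Set.mem_ofPred_eq, List.forall_mem_cons, Function.update_self,
      Function.update_of_ne h.1.symm]
    refine and_congr_right fun _ => forall₂_congr fun e' he' => ?_
    rw [Function.update_of_ne (h.2.1 e' he').1.symm, Function.update_of_ne (h.2.1 e' he').2.symm]
  by_cases hq : q ∈ linkSet l
  · have hind (w : E) : (linkSet (e :: l)).indicator (1 : (ι → E) → ENNReal)
        (Function.update q e.tip w) = {w | w - q e.base ∈ e.window}.indicator 1 w := by
      classical
      simp only [Set.indicator_apply, hupd, hq, and_true, Set.mem_ofPred_eq, Pi.one_apply]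
    have hmeas : MeasurableSet {w | w - q e.base ∈ e.window} := (measurable_id.sub_const _) he
    rw [lintegral_congr hind, lintegral_indicator_one hmeas]
    simpa [hq] using measure_sub_mem_le_concentration Λ e.window (q e.base)
  · simp [Set.indicator, hupd, hq]

variable [SigmaFinite Λ]

lemma lmarginal_linkSet_le {l : List (Link ι E)} (h : IsForest l)
    (hl : ∀ e ∈ l, MeasurableSet e.window) (q : ι → E) :
    (∫⋯∫⁻_(l.map Link.tip).toFinset, (linkSet l).indicator 1 ∂fun _ => Λ) q ≤
      (l.map fun e => concentration Λ e.window).prod := by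
  induction l generalizing q with
  | nil => simp [linkSet]
  | cons e l ih =>
    have hnotMem : e.tip ∉ (l.map Link.tip).toFinset := by
      simpa using fun e' he' => (h.2.1 e' he').1.symm
    have hmeas := measurableSet_linkSet hl
    rw [List.forall_mem_cons] at hl
    have hmeas' : Measurable fun u => (linkSet l).indicator (1 : (ι → E) → ENNReal)
        (Function.updateFinset q (l.map Link.tip).toFinset u) :=
      (measurable_one.indicator (measurableSet_linkSet hl.2)).comp measurable_updateFinset
    simp only [List.map_cons, List.toFinset_cons, List.prod_cons]
    rw [lmarginal_insert' _ (measurable_one.indicator hmeas) hnotMem]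
    refine (lmarginal_mono (fun q => lintegral_linkSet_cons_le h hl.1 q) q).trans ?_
    rw [lmarginal, lintegral_const_mul _ hmeas']
    gcongr
    exact ih h.2.2 hl.2 q

lemma lmarginal_indicator_le_of_subset_linkSet {l : List (Link ι E)} (h : IsForest l)
    (hl : ∀ e ∈ l, MeasurableSet e.window) {S : Set (ι → E)} (hS : S ⊆ linkSet l) {s : Finset ι}
    (hs : s = (l.map Link.tip).toFinset) (q : ι → E) :
    (∫⋯∫⁻_s, S.indicator 1 ∂fun _ => Λ) q ≤ (l.map fun e => concentration Λ e.window).prod :=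
  (lmarginal_mono (Set.indicator_le_indicator_of_subset hS fun _ => zero_le) q).trans
    (hs ▸ lmarginal_linkSet_le h hl q)

lemma pi_linkSet_le [Fintype ι] {l : List (Link ι E)} (h : IsForest l)
    (hl : ∀ e ∈ l, MeasurableSet e.window) {k : ι} (hk : k ∉ (l.map Link.tip).toFinset)
    (hcover : insert k (l.map Link.tip).toFinset = .univ) :
    Measure.pi (fun _ => Λ) (linkSet l) ≤
      Λ .univ * (l.map fun e => concentration Λ e.window).prod := by
  rcases isEmpty_or_nonempty (ι → E) with _ | ⟨⟨q⟩⟩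
  · simp [Set.eq_empty_of_isEmpty]
  have hm := measurableSet_linkSet hl
  rw [← lintegral_indicator_one hm, lintegral_eq_lmarginal_univ (μ := fun _ => Λ) q, ← hcover,
    lmarginal_insert _ (measurable_one.indicator hm) hk, mul_comm, ← lintegral_const]
  exact lintegral_mono fun w => lmarginal_linkSet_le h hl _

end ForestIntegration

section Tubes

variable {E : Type*} [NormedAddCommGroup E] [InnerProductSpace ℝ E]

/-- The tube of radius `ρ` around the orthogonal complement of `L`. -/
def tube (L : Submodule ℝ E) [L.HasOrthogonalProjection] (ρ : ℝ) : Set E :=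
  {v | ‖L.starProjection v‖ ≤ ρ}

variable {L : Submodule ℝ E} [L.HasOrthogonalProjection] {ρ ρ' : ℝ} {v w : E}

lemma measurableSet_tube [MeasurableSpace E] [OpensMeasurableSpace E] :
    MeasurableSet (tube L ρ) :=
  (isClosed_le (by fun_prop) continuous_const).measurableSet

lemma closedBall_subset_tube : Metric.closedBall 0 ρ ⊆ tube L ρ := fun _ hv =>
  (L.norm_starProjection_apply_le _).trans (mem_closedBall_zero_iff.1 hv)

lemma add_mem_tube (hv : v ∈ tube L ρ) (hw : w ∈ tube L ρ') : v + w ∈ tube L (ρ + ρ') := by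
  simp only [tube, Set.mem_ofPred_eq, map_add] at *
  exact norm_add_le_of_le hv hw

lemma sub_mem_tube (hv : v ∈ tube L ρ) (hw : w ∈ tube L ρ') : v - w ∈ tube L (ρ + ρ') := by
  simp only [tube, Set.mem_ofPred_eq, map_sub] at *
  exact norm_sub_le_of_le hv hw

end Tubes

section CrossingPairs

/-- The quadruples of points which form two edges of length at most `r` whose projections onto `L`
meet. -/
def crossSet (r : ℝ) (L : Submodule ℝ E3) : Set (Fin 4 → E3) :=
  {p | ‖p 0 - p 1‖ ≤ r ∧ ‖p 2 - p 3‖ ≤ r ∧ (crossing L p).Nonempty}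

/-- The index of the other end of an edge of a crossing pair of edges. -/
def partner : Fin 4 → Fin 4 := ![1, 0, 3, 2]

lemma isClosed_crossSet (r : ℝ) (L : Submodule ℝ E3) : IsClosed (crossSet r L) := by
  let F : Set ((unitInterval × unitInterval) × (Fin 4 → E3)) :=
    {a | L.starProjection ((1 - (a.1.1 : ℝ)) • a.2 0 + (a.1.1 : ℝ) • a.2 1) =
      L.starProjection ((1 - (a.1.2 : ℝ)) • a.2 2 + (a.1.2 : ℝ) • a.2 3)}
  have hF : IsClosed F := isClosed_eq (by fun_prop) (by fun_prop)
  have hset : crossSet r L =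
      {p | ‖p 0 - p 1‖ ≤ r} ∩ ({p | ‖p 2 - p 3‖ ≤ r} ∩ Prod.snd '' F) := by
    ext p
    refine and_congr Iff.rfl (and_congr Iff.rfl ?_)
    simp only [crossing, projSegment, segment_eq_image]
    constructor
    · rintro ⟨_, ⟨_, ⟨a, ha, rfl⟩, rfl⟩, ⟨_, ⟨b, hb, rfl⟩, h⟩⟩
      exact ⟨((⟨a, ha⟩, ⟨b, hb⟩), p), h.symm, rfl⟩
    · rintro ⟨⟨⟨a, b⟩, p⟩, h, rfl⟩
      exact ⟨_, ⟨_, ⟨a, a.2, rfl⟩, rfl⟩, ⟨_, ⟨b, b.2, rfl⟩, Eq.symm h⟩⟩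
  rw [hset]
  exact (isClosed_le (by fun_prop) continuous_const).inter
    ((isClosed_le (by fun_prop) continuous_const).inter
      (isClosedMap_snd_of_compactSpace F hF))

lemma crossingCount_eq_toReal_tupleMeasure {V : Set E3} (hV : V.Finite) (r : ℝ)
    (L : Submodule ℝ E3) :
    crossingCount V r L L = 1 / 8 * (tupleMeasure (Fin 4) V (crossSet r L)).toReal := by
  have hset : {p ∈ crossingTuples V r L | crossing L p ⊆ L} =
      crossSet r L ∩ injTuples (Fin 4) V := by
    ext p
    refine ⟨fun h => ⟨h.1.2.2, h.1.1, h.1.2.1⟩, fun h => ⟨⟨h.2.1, h.2.2, h.1⟩, ?_⟩⟩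
    rintro _ ⟨⟨v, -, rfl⟩, -⟩
    exact L.starProjection_apply_mem v
  rw [crossingCount, hset, tupleMeasure_apply hV (isClosed_crossSet r L).measurableSet,
    ← ((injTuples_finite hV).inter_of_right _).cast_ncard_eq]
  simp

variable {r : ℝ} {L : Submodule ℝ E3} {p : Fin 4 → E3}

lemma sub_partner_mem_closedBall (hp : p ∈ crossSet r L) (i : Fin 4) :
    p i - p (partner i) ∈ Metric.closedBall 0 r := by
  rw [mem_closedBall_zero_iff]
  fin_cases i
  · exact hp.1
  · exact (norm_sub_rev _ _).trans_le hp.1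
  · exact hp.2.1
  · exact (norm_sub_rev _ _).trans_le hp.2.1

lemma exists_forall_sub_mem_tube (hp : p ∈ crossSet r L) : ∃ c, ∀ i, p i - c ∈ tube L r := by
  obtain ⟨h01, h23, _, ⟨a, ha, rfl⟩, ⟨b, hb, hab⟩⟩ := hp
  have hleft {u v c : E3} (hc : c ∈ segment ℝ u v) (huv : ‖u - v‖ ≤ r) : u - c ∈ tube L r :=
    closedBall_subset_tube <| mem_closedBall_zero_iff.2 <| by
      simpa only [norm_sub_rev] using (norm_sub_le_of_mem_segment hc).trans
        ((norm_sub_rev _ _).trans_le huv)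
  have hright {u v c : E3} (hc : c ∈ segment ℝ u v) (huv : ‖u - v‖ ≤ r) : v - c ∈ tube L r :=
    hleft (segment_symm ℝ u v ▸ hc) ((norm_sub_rev _ _).trans_le huv)
  have hmove {u : E3} (hu : u - b ∈ tube L r) : u - a ∈ tube L r := by
    simpa only [tube, Set.mem_ofPred_eq, map_sub, hab] using hu
  refine ⟨a, fun i => ?_⟩
  fin_cases i
  · exact hleft ha h01
  · exact hright ha h01
  · exact hmove (hleft hb h23)
  · exact hmove (hright hb h23)

lemma sub_mem_tube_of_mem_crossSet (hp : p ∈ crossSet r L) (i j : Fin 4) :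
    p i - p j ∈ tube L (2 * r) := by
  obtain ⟨c, hc⟩ := exists_forall_sub_mem_tube hp
  rw [← sub_sub_sub_cancel_right _ _ c, two_mul]
  exact sub_mem_tube (hc i) (hc j)

lemma sub_mem_closedBall_of_eq_or_eq_partner (hp : p ∈ crossSet r L) {i j : Fin 4}
    (h : j = i ∨ j = partner i) : p i - p j ∈ Metric.closedBall 0 r := by
  rcases h with rfl | rfl
  · simpa using (norm_nonneg _).trans hp.1
  · exact sub_partner_mem_closedBall hp i

end CrossingPairs

section CrossingMarginals

/-- The constraint that the edge with tip `i` has length at most `r`. -/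
def edgeLink (r : ℝ) (i : Fin 4) : Link (Fin 4) E3 := ⟨i, partner i, Metric.closedBall 0 r⟩

/-- The constraint that the points `i` and `j` of two crossing edges have close projections. -/
def crossLink (r : ℝ) (L : Submodule ℝ E3) (i j : Fin 4) : Link (Fin 4) E3 :=
  ⟨i, j, tube L (2 * r)⟩

variable {Λ : Measure E3} [SigmaFinite Λ] {r : ℝ} {L : Submodule ℝ E3} {s : Finset (Fin 4)}
  {b τ : ENNReal}

lemma lmarginal_crossSet_le {l : List (Link (Fin 4) E3)} (h : IsForest l)
    (hl : ∀ e ∈ l, e = edgeLink r e.tip ∨ e = crossLink r L e.tip e.base)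
    (hs : s = (l.map Link.tip).toFinset) (q : Fin 4 → E3) :
    (∫⋯∫⁻_s, (crossSet r L).indicator 1 ∂fun _ => Λ) q ≤
      (l.map fun e => concentration Λ e.window).prod := by
  refine lmarginal_indicator_le_of_subset_linkSet h (fun e he => ?_) (fun p hp e he => ?_) hs q
  · rcases hl e he with h | h <;> rw [h]
    exacts [Metric.isClosed_closedBall.measurableSet, measurableSet_tube]
  · rcases hl e he with h | h <;> rw [h]
    exacts [sub_partner_mem_closedBall hp _, sub_mem_tube_of_mem_crossSet hp _ _]

lemma partner_ne (i : Fin 4) : partner i ≠ i := by revert i; decide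

lemma lmarginal_crossSet_le_of_card_one (hb : concentration Λ (Metric.closedBall 0 r) ≤ b)
    (hs : s.card = 1) (q : Fin 4 → E3) :
    (∫⋯∫⁻_s, (crossSet r L).indicator 1 ∂fun _ => Λ) q ≤ b := by
  obtain ⟨i, rfl⟩ := Finset.card_eq_one.1 hs
  refine (lmarginal_crossSet_le (l := [edgeLink r i]) ?_ ?_ ?_ q).trans ?_
  · simp [IsForest, edgeLink, (partner_ne i).symm]
  · simp [edgeLink]
  · simp [edgeLink]
  · simpa [edgeLink] using hb

lemma lmarginal_crossSet_le_of_card_two (hb : concentration Λ (Metric.closedBall 0 r) ≤ b)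
    (hτ : concentration Λ (tube L (2 * r)) ≤ τ) (hs : s.card = 2) (q : Fin 4 → E3) :
    (∫⋯∫⁻_s, (crossSet r L).indicator 1 ∂fun _ => Λ) q ≤ b * τ + b * b := by
  have hcases : (∃ i k, s = {i, partner i} ∧ k ≠ i ∧ k ≠ partner i) ∨
      ∃ i j, s = {i, j} ∧ i ≠ j ∧ partner j ≠ i := by
    revert s; decide
  obtain ⟨i, k, rfl, hki, hkp⟩ | ⟨i, j, rfl, hij, hj⟩ := hcases
  · refine (lmarginal_crossSet_le (l := [edgeLink r i, crossLink r L (partner i) k])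
      ?_ ?_ ?_ q).trans ?_
    · simp [IsForest, edgeLink, crossLink, (partner_ne i).symm, hki.symm, hkp.symm]
    · simp [edgeLink, crossLink]
    · simp [edgeLink, crossLink]
    · simpa [edgeLink, crossLink] using (mul_le_mul' hb hτ).trans le_self_add
  · refine (lmarginal_crossSet_le (l := [edgeLink r i, edgeLink r j]) ?_ ?_ ?_ q).trans ?_
    · simp [IsForest, edgeLink, (partner_ne _).symm, hij, hj.symm]
    · simp [edgeLink]
    · simp [edgeLink]
    · simpa [edgeLink] using (mul_le_mul' hb hb).trans le_add_self

lemma lmarginal_crossSet_le_of_card_three (hb : concentration Λ (Metric.closedBall 0 r) ≤ b)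
    (hτ : concentration Λ (tube L (2 * r)) ≤ τ) (hs : s.card = 3) (q : Fin 4 → E3) :
    (∫⋯∫⁻_s, (crossSet r L).indicator 1 ∂fun _ => Λ) q ≤ b * (b * τ) := by
  obtain ⟨i, j, rfl, hij, hij', hi, hi'⟩ : ∃ i j, s = {i, j, partner j} ∧ i ≠ j ∧
      i ≠ partner j ∧ partner i ≠ j ∧ partner i ≠ partner j := by
    revert s; decide
  refine (lmarginal_crossSet_le
    (l := [edgeLink r i, edgeLink r j, crossLink r L (partner j) (partner i)]) ?_ ?_ ?_ q).trans ?_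
  · simp [IsForest, edgeLink, crossLink, (partner_ne _).symm, hij, hij', hi.symm, hi'.symm]
  · simp [edgeLink, crossLink]
  · simp [edgeLink, crossLink]
  · simpa [edgeLink, crossLink] using mul_le_mul' hb (mul_le_mul' hb hτ)

lemma pi_crossSet_inter_le (hb : concentration Λ (Metric.closedBall 0 r) ≤ b) {T : Set E3}
    (hT : MeasurableSet T) {D : ENNReal} (hD : concentration Λ T ≤ D) :
    Measure.pi (fun _ : Fin 4 => Λ) (crossSet r L ∩ {p | p 2 - p 0 ∈ T}) ≤
      Λ .univ * (b * (b * D)) := by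
  let l : List (Link (Fin 4) E3) := [edgeLink r 1, edgeLink r 3, ⟨2, 0, T⟩]
  have hsub : crossSet r L ∩ {p | p 2 - p 0 ∈ T} ⊆ linkSet l := fun p hp => by
    simpa [l, linkSet, edgeLink] using
      ⟨by simpa using sub_partner_mem_closedBall hp.1 1,
        by simpa using sub_partner_mem_closedBall hp.1 3, hp.2⟩
  refine (measure_mono hsub).trans ((pi_linkSet_le (k := 0) ?_ ?_ ?_ ?_).trans ?_)
  · simp [l, IsForest, edgeLink, partner]
  · simp [l, edgeLink, hT, measurableSet_closedBall]
  · simp [l, edgeLink]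
  · exact (by decide : insert 0 [1, 3, 2].toFinset = (Finset.univ : Finset (Fin 4)))
  · simpa [l, edgeLink] using mul_le_mul_right (mul_le_mul' hb (mul_le_mul' hb hD)) (Λ .univ)

end CrossingMarginals

section CrossingCovariance

variable {r : ℝ} {L L' : Submodule ℝ E3} {f : Fin 4 → Option (Fin 4)}

lemma sub_mem_tube_of_glue_mem_crossSet (hf : f ∈ overlapPatterns (Fin 4))
    (hcard : (freshIndices f).card ≤ 1) {p : Fin 4 → E3} {u : freshIndices f → E3}
    (hp : p ∈ crossSet r L) (hq : glue f p u ∈ crossSet r L') :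
    p 2 - p 0 ∈ tube L' (4 * r) := by
  have hlt {e : Finset (Fin 4)} (he : e.card = 2) : e.card < (freshIndices f)ᶜ.card := by
    rw [Finset.card_compl, Fintype.card_fin]
    lia
  obtain ⟨i, a, hi, ha⟩ := exists_eq_some_notMem_of_card_lt hf (hlt (e := {2, 3}) rfl)
  obtain ⟨j, c, hj, hc⟩ := exists_eq_some_notMem_of_card_lt hf (hlt (e := {0, 1}) rfl)
  have ha' : 0 = a ∨ 0 = partner a :=
    (by decide : ∀ a : Fin 4, a ∉ ({2, 3} : Finset _) → 0 = a ∨ 0 = partner a) a ha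
  have hc' : c = 2 ∨ c = partner 2 :=
    (by decide : ∀ c : Fin 4, c ∉ ({0, 1} : Finset _) → c = 2 ∨ c = partner 2) c hc
  have hmid := sub_mem_tube_of_mem_crossSet hq j i
  rw [glue_of_eq_some hi, glue_of_eq_some hj] at hmid
  rw [show p 2 - p 0 = (p 2 - p c) + (p c - p a) + (p a - p 0) by abel,
    show 4 * r = r + 2 * r + r by ring]
  exact add_mem_tube (add_mem_tube
    (closedBall_subset_tube (sub_mem_closedBall_of_eq_or_eq_partner hp hc')) hmid)
    (closedBall_subset_tube (sub_mem_closedBall_of_eq_or_eq_partner hp ha'))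

variable {Λ : Measure E3} [IsFiniteMeasure Λ] {b τ D : ENNReal}

lemma pi_overlapSet_crossSet_le_of_one_lt (hb : concentration Λ (Metric.closedBall 0 r) ≤ b)
    (hτ : concentration Λ (tube L (2 * r)) ≤ τ) (hτ' : concentration Λ (tube L' (2 * r)) ≤ τ)
    (hf : f ≠ fun _ => none) (hcard : 1 < (freshIndices f).card) :
    Measure.pi (fun _ => Λ) (overlapSet f (crossSet r L) (crossSet r L')) ≤
      (b * (b * τ) + (b * τ + b * b)) * (Λ .univ * (b * (b * τ))) := by
  have hmarginal (q : Fin 4 → E3) :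
      (∫⋯∫⁻_freshIndices f, (crossSet r L').indicator 1 ∂fun _ => Λ) q ≤
        b * (b * τ) + (b * τ + b * b) := by
    have h4 := card_freshIndices_lt hf
    rw [Fintype.card_fin] at h4
    obtain h | h : (freshIndices f).card = 2 ∨ (freshIndices f).card = 3 := by lia
    · exact (lmarginal_crossSet_le_of_card_two hb hτ' h q).trans le_add_self
    · exact (lmarginal_crossSet_le_of_card_three hb hτ' h q).trans le_self_add
  refine (pi_overlapSet_le (isClosed_crossSet r L).measurableSet
    (isClosed_crossSet r L').measurableSet hmarginal).trans ?_
  gcongr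
  have hsub : crossSet r L ⊆ crossSet r L ∩ {p | p 2 - p 0 ∈ tube L (2 * r)} :=
    fun p hp => ⟨hp, sub_mem_tube_of_mem_crossSet hp 2 0⟩
  exact (measure_mono hsub).trans (pi_crossSet_inter_le hb measurableSet_tube hτ)

lemma pi_overlapSet_crossSet_le_of_le_one (hb : concentration Λ (Metric.closedBall 0 r) ≤ b)
    (hD : concentration Λ (tube L (2 * r) ∩ tube L' (4 * r)) ≤ D)
    (hf : f ∈ overlapPatterns (Fin 4)) (hcard : (freshIndices f).card ≤ 1) :
    Measure.pi (fun _ => Λ) (overlapSet f (crossSet r L) (crossSet r L')) ≤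
      (1 + b) * (Λ .univ * (b * (b * D))) := by
  let T := tube L (2 * r) ∩ tube L' (4 * r)
  have hT : MeasurableSet T := measurableSet_tube.inter measurableSet_tube
  have hdiff : MeasurableSet {p : Fin 4 → E3 | p 2 - p 0 ∈ T} :=
    (show Measurable fun p : Fin 4 → E3 => p 2 - p 0 by fun_prop) hT
  have hmarginal (q : Fin 4 → E3) :
      (∫⋯∫⁻_freshIndices f, (crossSet r L').indicator 1 ∂fun _ => Λ) q ≤ 1 + b := by
    obtain h | h : (freshIndices f).card = 0 ∨ (freshIndices f).card = 1 := by lia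
    · rw [Finset.card_eq_zero.1 h, lmarginal_empty]
      exact (Set.indicator_le_self' (fun _ _ => zero_le_one) q).trans le_self_add
    · exact (lmarginal_crossSet_le_of_card_one hb h q).trans le_add_self
  have hsub : overlapSet f (crossSet r L) (crossSet r L') ⊆
      overlapSet f (crossSet r L ∩ {p | p 2 - p 0 ∈ T}) (crossSet r L') := fun s hs =>
    ⟨⟨hs.1, sub_mem_tube_of_mem_crossSet hs.1 2 0,
      sub_mem_tube_of_glue_mem_crossSet hf hcard hs.1 hs.2⟩, hs.2⟩
  refine (measure_mono hsub).trans ((pi_overlapSet_le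
    ((isClosed_crossSet r L).measurableSet.inter hdiff)
    (isClosed_crossSet r L').measurableSet hmarginal).trans ?_)
  gcongr
  exact pi_crossSet_inter_le hb hT hD

lemma sum_pi_overlapSet_crossSet_le (hb : concentration Λ (Metric.closedBall 0 r) ≤ b)
    (hτ : concentration Λ (tube L (2 * r)) ≤ τ) (hτ' : concentration Λ (tube L' (2 * r)) ≤ τ)
    (hD : concentration Λ (tube L (2 * r) ∩ tube L' (4 * r)) ≤ D) :
    ∑ f ∈ (overlapPatterns (Fin 4)).erase fun _ => none,
        Measure.pi (fun _ => Λ) (overlapSet f (crossSet r L) (crossSet r L')) ≤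
      625 * ((b * (b * τ) + (b * τ + b * b)) * (Λ .univ * (b * (b * τ))) +
        (1 + b) * (Λ .univ * (b * (b * D)))) := by
  have hcard : ((overlapPatterns (Fin 4)).erase fun _ => none).card ≤ 625 :=
    (Finset.card_le_univ _).trans_eq (by simp)
  refine (Finset.sum_le_card_nsmul _ _ _ fun f hf => ?_).trans
    ((nsmul_eq_mul _ _).trans_le (by gcongr; exact_mod_cast hcard))
  rw [Finset.mem_erase] at hf
  rcases lt_or_ge 1 (freshIndices f).card with h | h
  · exact (pi_overlapSet_crossSet_le_of_one_lt hb hτ hτ' hf.1 h).trans le_self_add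
  · exact (pi_overlapSet_crossSet_le_of_le_one hb hD hf.2 h).trans le_add_self

/-- A bound for the contribution to the covariance of crossing counts of the pairs of crossings
with one or two common points, in terms of bounds for the intensity of the whole space (`m`), of
balls around a vertex (`b`) and of tubes around a vertex (`τ`). -/
noncomputable def lowOverlapBound (m b τ : ℝ) : ℝ :=
  (b * (b * τ) + (b * τ + b * b)) * (m * (b * (b * τ)))

/-- A bound for the contribution to the covariance of crossing counts of the pairs of crossings
with three or four common points, in terms of bounds for the intensity of the whole space (`m`), of
balls around a vertex (`b`) and of intersections of two tubes around a vertex (`D`). -/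
noncomputable def highOverlapBound (m b D : ℝ) : ℝ :=
  (1 + b) * (m * (b * (b * D)))

variable {Ω : Type*} [MeasurableSpace Ω] {P : Measure Ω} {η : Ω → Set E3}

namespace IsPoissonProcess

lemma exists_crossingCount_ae_eq (h : IsPoissonProcess P Λ η) :
    ∃ η', IsPoissonProcess P Λ η' ∧ (∀ ω, (η' ω).Finite) ∧ ∀ r L,
      (fun ω => crossingCount (η ω) r L L) =ᵐ[P]
        fun ω => 1 / 8 * (tupleMeasure (Fin 4) (η' ω) (crossSet r L)).toReal := by
  obtain ⟨η', h', hfin, hae⟩ := h.exists_finite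
  refine ⟨η', h', hfin, fun r L => ?_⟩
  filter_upwards [hae] with ω hω
  rw [← hω, crossingCount_eq_toReal_tupleMeasure (hfin ω)]

variable [NullSingletonClass Λ]

theorem memLp_crossingCount (h : IsPoissonProcess P Λ η) (r : ℝ) (L : Submodule ℝ E3) :
    MemLp (fun ω => crossingCount (η ω) r L L) 2 P := by
  obtain ⟨η', h', hfin, hcount⟩ := h.exists_crossingCount_ae_eq
  exact (memLp_congr_ae (hcount r L)).2
    ((h'.memLp_tupleMeasure hfin (isClosed_crossSet r L).measurableSet).const_mul _)

theorem covariance_crossingCount_le [IsProbabilityMeasure P] (h : IsPoissonProcess P Λ η)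
    {m b τ D : ℝ} (hm₀ : 0 ≤ m) (hb₀ : 0 ≤ b) (hτ₀ : 0 ≤ τ) (hD₀ : 0 ≤ D)
    (hm : Λ .univ ≤ ENNReal.ofReal m)
    (hb : concentration Λ (Metric.closedBall 0 r) ≤ ENNReal.ofReal b)
    (hτ : concentration Λ (tube L (2 * r)) ≤ ENNReal.ofReal τ)
    (hτ' : concentration Λ (tube L' (2 * r)) ≤ ENNReal.ofReal τ)
    (hD : concentration Λ (tube L (2 * r) ∩ tube L' (4 * r)) ≤ ENNReal.ofReal D) :
    cov[fun ω => crossingCount (η ω) r L L, fun ω => crossingCount (η ω) r L' L'; P] ≤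
      10 * (lowOverlapBound m b τ + highOverlapBound m b D) := by
  obtain ⟨η', h', hfin, hcount⟩ := h.exists_crossingCount_ae_eq
  lift m to NNReal using hm₀
  lift b to NNReal using hb₀
  lift τ to NNReal using hτ₀
  lift D to NNReal using hD₀
  simp only [ENNReal.ofReal_coe_nnreal] at hm hb hτ hτ' hD
  set B : NNReal := (b * (b * τ) + (b * τ + b * b)) * (m * (b * (b * τ))) +
    (1 + b) * (m * (b * (b * D))) with hB_def
  have hB : lowOverlapBound m b τ + highOverlapBound m b D = B := by
    simp [lowOverlapBound, highOverlapBound, hB_def]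
  have hcov := h'.covariance_tupleMeasure_le hfin (isClosed_crossSet r L).measurableSet
    (isClosed_crossSet r L').measurableSet (β := 625 * B)
    ((sum_pi_overlapSet_crossSet_le hb hτ hτ' hD).trans (by push_cast [B]; gcongr))
  rw [covariance_congr_ae (hcount r L) (hcount r L'), covariance_const_mul_left,
    covariance_const_mul_right, hB]
  push_cast at hcov
  linarith [B.coe_nonneg]

end IsPoissonProcess

end CrossingCovariance

section TubeVolumes

variable {E : Type*} [NormedAddCommGroup E] [InnerProductSpace ℝ E] {x y : E}

lemma starProjection_orthogonal_span_singleton (hx : ‖x‖ = 1) (v : E) :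
    (ℝ ∙ x)ᗮ.starProjection v = v - inner ℝ x v • x := by
  rw [Submodule.starProjection_orthogonal_val, Submodule.starProjection_unit_singleton ℝ hx]

lemma norm_starProjection_orthogonal_span_singleton (hx : ‖x‖ = 1) (hy : ‖y‖ = 1) :
    ‖(ℝ ∙ y)ᗮ.starProjection x‖ = Real.sin (InnerProductGeometry.angle x y) := by
  have hcos : Real.cos (InnerProductGeometry.angle x y) = inner ℝ y x := by
    rw [InnerProductGeometry.cos_angle, hx, hy, real_inner_comm]
    simp
  rw [← sq_eq_sq₀ (norm_nonneg _) (InnerProductGeometry.sin_angle_nonneg x y), Real.sin_sq, hcos,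
    starProjection_orthogonal_span_singleton hy, norm_sub_sq_real, norm_smul, inner_smul_right,
    real_inner_comm, hx, hy, Real.norm_eq_abs, mul_one, sq_abs]
  ring

lemma abs_inner_mul_sin_angle_le (hx : ‖x‖ = 1) (hy : ‖y‖ = 1) (v : E) :
    |inner ℝ x v| * Real.sin (InnerProductGeometry.angle x y) ≤
      ‖(ℝ ∙ x)ᗮ.starProjection v‖ + ‖(ℝ ∙ y)ᗮ.starProjection v‖ := by
  have hsplit : inner ℝ x v • x = v - (ℝ ∙ x)ᗮ.starProjection v := by
    rw [starProjection_orthogonal_span_singleton hx, sub_sub_cancel]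
  rw [← norm_starProjection_orthogonal_span_singleton hx hy, ← Real.norm_eq_abs, ← norm_smul,
    ← map_smul, hsplit, map_sub, add_comm]
  exact norm_sub_le_of_le le_rfl (Submodule.norm_starProjection_apply_le _ _)

lemma tube_inter_tube_subset (hx : ‖x‖ = 1) (hy : ‖y‖ = 1) {δ ρ ρ' : ℝ} (hδ : 0 < δ)
    (hsin : δ ≤ Real.sin (InnerProductGeometry.angle x y)) :
    tube (ℝ ∙ x)ᗮ ρ ∩ tube (ℝ ∙ y)ᗮ ρ' ⊆
      {v | |inner ℝ x v| ≤ (ρ + ρ') / δ} ∩ tube (ℝ ∙ x)ᗮ ρ := by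
  rintro v ⟨hvx, hvy⟩
  refine ⟨?_, hvx⟩
  rw [Set.mem_ofPred_eq, le_div_iff₀ hδ]
  calc |inner ℝ x v| * δ ≤ |inner ℝ x v| * Real.sin (InnerProductGeometry.angle x y) := by gcongr
    _ ≤ ρ + ρ' := (abs_inner_mul_sin_angle_le hx hy v).trans (add_le_add hvx hvy)

variable [FiniteDimensional ℝ E] [MeasurableSpace E] [BorelSpace E]

lemma volume_setOf_inner_mem {ι : Type*} [Fintype ι] (b : OrthonormalBasis ι ℝ E)
    {I : ι → Set ℝ} (hI : ∀ i, MeasurableSet (I i)) :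
    volume {v | ∀ i, inner ℝ (b i) v ∈ I i} = ∏ i, volume (I i) := by
  have hcoord : MeasurePreserving (fun v => (b.repr v).ofLp) volume volume :=
    (PiLp.volume_preserving_ofLp ι).comp b.measurePreserving_repr
  have hset : {v | ∀ i, inner ℝ (b i) v ∈ I i} =
      (fun v => (b.repr v).ofLp) ⁻¹' Set.univ.pi I := by
    ext v
    simp [b.repr_apply_apply]
  rw [hset, hcoord.measure_preimage (MeasurableSet.univ_pi hI).nullMeasurableSet, volume_pi_pi]

lemma volume_slab_inter_tube_le {n : ℕ} (hn : Module.finrank ℝ E = n + 1) (hx : ‖x‖ = 1)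
    (a H ρ : ℝ) :
    volume ({v | |inner ℝ x v - a| ≤ H} ∩ tube (ℝ ∙ x)ᗮ ρ) ≤
      ENNReal.ofReal (2 * H) * ENNReal.ofReal (2 * ρ) ^ n := by
  have hortho : Orthonormal ℝ (({0} : Set (Fin (n + 1))).domRestrict fun _ => x) :=
    ⟨fun _ => hx, fun i j hij => (hij (Subsingleton.elim i j)).elim⟩
  obtain ⟨b, hb⟩ := hortho.exists_orthonormalBasis_extension_of_card_eq (by simpa using hn)
  have hb0 : b 0 = x := hb 0 rfl
  have hperp (i : Fin n) (v : E) :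
      inner ℝ (b i.succ) v = inner ℝ (b i.succ) ((ℝ ∙ x)ᗮ.starProjection v) := by
    rw [starProjection_orthogonal_span_singleton hx, inner_sub_right, inner_smul_right, ← hb0,
      b.orthonormal.2 i.succ_ne_zero, mul_zero, sub_zero]
  have hcoord (i : Fin n) (v : E) : |inner ℝ (b i.succ) v| ≤ ‖(ℝ ∙ x)ᗮ.starProjection v‖ := by
    rw [hperp]
    simpa using abs_real_inner_le_norm (b i.succ) ((ℝ ∙ x)ᗮ.starProjection v)
  let I : Fin (n + 1) → Set ℝ := Fin.cons (Metric.closedBall a H) fun _ => Metric.closedBall 0 ρ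
  have hI (i) : MeasurableSet (I i) := by
    cases i using Fin.cases <;> exact measurableSet_closedBall
  have hsub : {v | |inner ℝ x v - a| ≤ H} ∩ tube (ℝ ∙ x)ᗮ ρ ⊆ {v | ∀ i, inner ℝ (b i) v ∈ I i} := by
    rintro v ⟨hva, hv⟩ i
    cases i using Fin.cases with
    | zero => simpa [I, hb0, Real.dist_eq] using hva
    | succ i => simpa [I] using (hcoord i v).trans hv
  refine (measure_mono hsub).trans_eq ?_
  simp [volume_setOf_inner_mem b hI, Fin.prod_univ_succ, I, Real.volume_closedBall]

end TubeVolumes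

section Concentration

lemma concentration_le_of_le_smul {G : Type*} [AddGroup G] [MeasurableSpace G] [MeasurableAdd G]
    {μ Λ : Measure G} [μ.IsAddRightInvariant] {c : ENNReal} (hΛ : Λ ≤ c • μ) (T : Set G) :
    concentration Λ T ≤ c * μ T := by
  refine iSup_le fun w => (hΛ _).trans_eq ?_
  have hpre : {v | v - w ∈ T} = (· + -w) ⁻¹' T := by
    simp only [sub_eq_add_neg]
    rfl
  rw [hpre, Measure.smul_apply, measure_preimage_add_right, smul_eq_mul]

variable {E : Type*} [NormedAddCommGroup E] [InnerProductSpace ℝ E] [FiniteDimensional ℝ E]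
  [MeasurableSpace E] [BorelSpace E] {Λ : Measure E} {c : ENNReal} {x y : E} {n : ℕ} {ρ : ℝ}

lemma concentration_tube_le {z : E} {R : ℝ}
    (hΛ : Λ ≤ c • volume.restrict (Metric.closedBall z R)) (hn : Module.finrank ℝ E = n + 1)
    (hx : ‖x‖ = 1) :
    concentration Λ (tube (ℝ ∙ x)ᗮ ρ) ≤
      c * (ENNReal.ofReal (2 * R) * ENNReal.ofReal (2 * ρ) ^ n) := by
  refine iSup_le fun w => (hΛ _).trans ?_
  rw [Measure.smul_apply, smul_eq_mul, Measure.restrict_apply' measurableSet_closedBall]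
  gcongr
  let S : Set E := {v | |inner ℝ x v - inner ℝ x (z - w)| ≤ R} ∩ tube (ℝ ∙ x)ᗮ ρ
  have hsub : {v | v - w ∈ tube (ℝ ∙ x)ᗮ ρ} ∩ Metric.closedBall z R ⊆ (· + -w) ⁻¹' S := by
    rintro v ⟨hv, hvz⟩
    rw [Set.mem_preimage, ← sub_eq_add_neg]
    refine ⟨?_, hv⟩
    rw [Set.mem_ofPred_eq, ← inner_sub_right, sub_sub_sub_cancel_right]
    refine (abs_real_inner_le_norm _ _).trans ?_
    rwa [hx, one_mul, ← dist_eq_norm]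
  refine (measure_mono hsub).trans ?_
  rw [measure_preimage_add_right]
  exact volume_slab_inter_tube_le hn hx _ R ρ

lemma concentration_tube_inter_tube_le (hΛ : Λ ≤ c • volume) (hn : Module.finrank ℝ E = n + 1)
    (hx : ‖x‖ = 1) (hy : ‖y‖ = 1) {δ : ℝ} (hδ : 0 < δ)
    (hsin : δ ≤ Real.sin (InnerProductGeometry.angle x y)) (ρ' : ℝ) :
    concentration Λ (tube (ℝ ∙ x)ᗮ ρ ∩ tube (ℝ ∙ y)ᗮ ρ') ≤
      c * (ENNReal.ofReal (2 * ((ρ + ρ') / δ)) * ENNReal.ofReal (2 * ρ) ^ n) := by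
  refine (concentration_le_of_le_smul hΛ _).trans ?_
  gcongr
  refine (measure_mono (tube_inter_tube_subset hx hy hδ hsin)).trans ?_
  simpa using volume_slab_inter_tube_le hn hx 0 ((ρ + ρ') / δ) ρ

end Concentration

section Planes

lemma inner_rotate (Q : Matrix.specialOrthogonalGroup (Fin 3) ℝ) (u v : E3) :
    inner ℝ (rotate Q u) (rotate Q v) = inner ℝ u v := by
  have hQ : (Q : Matrix (Fin 3) (Fin 3) ℝ).transpose * (Q : Matrix (Fin 3) (Fin 3) ℝ) = 1 :=
    (Matrix.mem_orthogonalGroup_iff' _ _).1 (Matrix.mem_specialOrthogonalGroup_iff.1 Q.2).1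
  have hadj : LinearMap.adjoint (rotate Q) (rotate Q v) = v := by
    rw [rotate, ← Matrix.toEuclideanLin_conjTranspose_eq_adjoint]
    simp [Matrix.toLpLin_apply, hQ]
  rw [← LinearMap.adjoint_inner_right, hadj]

lemma rotate_injective (Q : Matrix.specialOrthogonalGroup (Fin 3) ℝ) :
    Function.Injective (rotate Q) :=
  ((rotate Q).isometryOfInner (inner_rotate Q)).injective

lemma mem_refPlane {w : E3} : w ∈ refPlane ↔ w 2 = 0 := by
  rw [refPlane, Submodule.mem_span_pair]
  constructor
  · rintro ⟨a, b, rfl⟩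
    simp
  · refine fun hw => ⟨w 0, w 1, ?_⟩
    ext i
    fin_cases i <;> simp [hw]

lemma plane_eq_orthogonal {θ : Sphere2 → Matrix.specialOrthogonalGroup (Fin 3) ℝ} {x : Sphere2}
    (hθ : rotate (θ x) (EuclideanSpace.single 2 1) = (x : E3)) :
    plane θ x = (ℝ ∙ (x : E3))ᗮ := by
  ext v
  obtain ⟨w, rfl⟩ := LinearMap.injective_iff_surjective.1 (rotate_injective (θ x)) v
  rw [Submodule.mem_orthogonal_singleton_iff_inner_right, ← hθ, inner_rotate,
    EuclideanSpace.inner_single_left, map_one, one_mul, ← mem_refPlane]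
  exact (rotate_injective (θ x)).mem_set_image

end Planes

section CrossingCovarianceOfDensity

/-- The value of `lowOverlapBound` for the connectivity radius `ρ` when the intensity has density
at most `t` and is carried by a ball of radius `R`. -/
noncomputable def lowOverlapBoundOfDensity (t R ρ : ℝ) : ℝ :=
  lowOverlapBound (t * (R ^ 3 * (Real.pi * 4 / 3))) (t * (ρ ^ 3 * (Real.pi * 4 / 3)))
    (t * (2 * R * (2 * (2 * ρ)) ^ 2))

/-- The value of `highOverlapBound` for the connectivity radius `ρ` when the intensity has density
at most `t` and is carried by a ball of radius `R`, and the sine of the angle between the two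
directions of projection is at least `δ`. -/
noncomputable def highOverlapBoundOfDensity (t R ρ δ : ℝ) : ℝ :=
  highOverlapBound (t * (R ^ 3 * (Real.pi * 4 / 3))) (t * (ρ ^ 3 * (Real.pi * 4 / 3)))
    (t * (2 * ((2 * ρ + 4 * ρ) / δ) * (2 * (2 * ρ)) ^ 2))

lemma lowOverlapBoundOfDensity_nonneg {t R ρ : ℝ} (ht : 0 ≤ t) (hR : 0 ≤ R) (hρ : 0 ≤ ρ) :
    0 ≤ lowOverlapBoundOfDensity t R ρ := by
  unfold lowOverlapBoundOfDensity lowOverlapBound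
  positivity

lemma highOverlapBoundOfDensity_pos {t R ρ δ : ℝ} (ht : 0 < t) (hR : 0 < R) (hρ : 0 < ρ)
    (hδ : 0 < δ) : 0 < highOverlapBoundOfDensity t R ρ δ := by
  unfold highOverlapBoundOfDensity highOverlapBound
  positivity

variable {Ω : Type*} [MeasurableSpace Ω] {P : Measure Ω} {Λ : Measure E3} {η : Ω → Set E3}
  {t : ℝ} {z : E3} {R : ℝ}

lemma isFiniteMeasure_of_le_smul_volume
    (hΛ : Λ ≤ ENNReal.ofReal t • volume.restrict (Metric.closedBall z R)) : IsFiniteMeasure Λ where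
  measure_univ_lt_top := (hΛ .univ).trans_lt (by
    rw [Measure.smul_apply, Measure.restrict_apply_univ, smul_eq_mul]
    exact ENNReal.mul_lt_top ENNReal.ofReal_lt_top measure_closedBall_lt_top)

lemma nullSingletonClass_of_le_smul_volume
    (hΛ : Λ ≤ ENNReal.ofReal t • volume.restrict (Metric.closedBall z R)) : NullSingletonClass Λ :=
  ⟨fun v => le_zero_iff.1 ((hΛ {v}).trans_eq (by simp))⟩

namespace IsPoissonProcess

theorem covariance_crossingCount_orthogonal_le [IsProbabilityMeasure P]
    (h : IsPoissonProcess P Λ η)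
    (hΛ : Λ ≤ ENNReal.ofReal t • volume.restrict (Metric.closedBall z R)) (ht : 0 ≤ t) (hR : 0 ≤ R)
    {r : ℝ} (hr : 0 ≤ r) {x y : E3} (hx : ‖x‖ = 1) (hy : ‖y‖ = 1) {δ : ℝ} (hδ : 0 < δ)
    (hsin : δ ≤ Real.sin (InnerProductGeometry.angle x y)) :
    cov[fun ω => crossingCount (η ω) r (ℝ ∙ x)ᗮ (ℝ ∙ x)ᗮ,
        fun ω => crossingCount (η ω) r (ℝ ∙ y)ᗮ (ℝ ∙ y)ᗮ; P] ≤
      10 * (lowOverlapBoundOfDensity t R r + highOverlapBoundOfDensity t R r δ) := by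
  have := isFiniteMeasure_of_le_smul_volume hΛ
  have := nullSingletonClass_of_le_smul_volume hΛ
  have hΛ' : Λ ≤ ENNReal.ofReal t • volume := hΛ.trans (by gcongr; exact Measure.restrict_le_self)
  have hE : Module.finrank ℝ E3 = 2 + 1 := finrank_euclideanSpace_fin
  have hball {s : ℝ} (hs : 0 ≤ s) (w : E3) : ENNReal.ofReal t * volume (Metric.closedBall w s) =
      ENNReal.ofReal (t * (s ^ 3 * (Real.pi * 4 / 3))) := by
    rw [EuclideanSpace.volume_closedBall_fin_three, ENNReal.ofReal_mul ht,
      ENNReal.ofReal_mul (by positivity), ENNReal.ofReal_pow hs]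
  have hbox {H : ℝ} (hH : 0 ≤ H) :
      ENNReal.ofReal t * (ENNReal.ofReal (2 * H) * ENNReal.ofReal (2 * (2 * r)) ^ 2) =
        ENNReal.ofReal (t * (2 * H * (2 * (2 * r)) ^ 2)) := by
    rw [ENNReal.ofReal_mul ht, ENNReal.ofReal_mul (mul_nonneg zero_le_two hH),
      ENNReal.ofReal_pow (by positivity)]
  refine h.covariance_crossingCount_le (by positivity) (by positivity) (by positivity)
    (by positivity) ?_ ?_ ?_ ?_ ?_
  · exact (hΛ .univ).trans_eq (by simpa using hball hR z)
  · exact (concentration_le_of_le_smul hΛ' _).trans_eq (hball hr 0)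
  · exact (concentration_tube_le hΛ hE hx).trans_eq (hbox hR)
  · exact (concentration_tube_le hΛ hE hy).trans_eq (hbox hR)
  · exact (concentration_tube_inter_tube_le hΛ' hE hx hy hδ hsin _).trans_eq
      (hbox (by positivity))

end IsPoissonProcess

end CrossingCovarianceOfDensity

section Asymptotics

variable {r m b τ D g : ℝ → ℝ}

lemma isBigO_one_of_mul_pow (hsparse : (fun t => t * r t ^ 3) =O[atTop] fun _ => (1 : ℝ)) :
    r =O[atTop] fun _ => (1 : ℝ) := by
  have hinv : (fun t : ℝ => t⁻¹) =O[atTop] fun _ => (1 : ℝ) :=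
    tendsto_inv_atTop_zero.isBigO_one ℝ
  refine IsBigO.of_pow (n := 3) (by decide) (((hinv.mul hsparse).congr' ?_ ?_))
  · filter_upwards [eventually_ne_atTop 0] with t ht
    simp [ht]
  · simp [Pi.pow_def]

lemma isBigO_lowOverlapBound (hsparse : (fun t => t * r t ^ 3) =O[atTop] fun _ => (1 : ℝ))
    (hm : m =O[atTop] fun t => t) (hb : b =O[atTop] fun t => t * r t ^ 3)
    (hτ : τ =O[atTop] fun t => t * r t ^ 2) :
    (fun t => lowOverlapBound (m t) (b t) (τ t)) =O[atTop] fun t => t ^ 6 * r t ^ 13 := by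
  have hr := isBigO_one_of_mul_pow hsparse
  have hbτ : (fun t => b t * τ t) =O[atTop] fun t => t ^ 2 * r t ^ 5 :=
    (hb.mul hτ).congr_right fun t => by ring
  have hbbτ : (fun t => b t * (b t * τ t)) =O[atTop] fun t => t ^ 2 * r t ^ 5 :=
    ((hb.trans hsparse).mul hbτ).congr_right fun t => by ring
  have hbb : (fun t => b t * b t) =O[atTop] fun t => t ^ 2 * r t ^ 5 :=
    ((hb.mul hb).trans <| ((isBigO_refl (fun t => t ^ 2 * r t ^ 5) atTop).mul hr).congr_left
      fun t => by ring).congr_right fun t => by ring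
  exact ((hbbτ.add (hbτ.add hbb)).mul (hm.mul (hb.mul (hb.mul hτ)))).congr_right fun t => by ring

lemma isBigO_highOverlapBound (hsparse : (fun t => t * r t ^ 3) =O[atTop] fun _ => (1 : ℝ))
    (hm : m =O[atTop] fun t => t) (hb : b =O[atTop] fun t => t * r t ^ 3)
    (hD : D =O[atTop] fun t => t * r t ^ 3 * g t) :
    (fun t => highOverlapBound (m t) (b t) (D t)) =O[atTop] fun t => t ^ 4 * g t * r t ^ 9 := by
  have hone : (fun t => 1 + b t) =O[atTop] fun _ => (1 : ℝ) :=
    (isBigO_refl _ _).add (hb.trans hsparse)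
  exact (hone.mul (hm.mul (hb.mul (hb.mul hD)))).congr_right fun t => by ring

lemma isBigO_lowOverlapBoundOfDensity (R : ℝ)
    (hsparse : (fun t => t * r t ^ 3) =O[atTop] fun _ => (1 : ℝ)) :
    (fun t => lowOverlapBoundOfDensity t R (r t)) =O[atTop] fun t => t ^ 6 * r t ^ 13 := by
  refine isBigO_lowOverlapBound hsparse ?_ ?_ ?_
  · exact ((isBigO_refl _ _).const_mul_left (R ^ 3 * (Real.pi * 4 / 3))).congr_left fun t => by ring
  · exact ((isBigO_refl _ _).const_mul_left (Real.pi * 4 / 3)).congr_left fun t => by ring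
  · exact ((isBigO_refl _ _).const_mul_left (32 * R)).congr_left fun t => by ring

lemma isBigO_highOverlapBoundOfDensity (R : ℝ) {κ : ℝ} (hκ : κ ≠ 0) (α : ℝ)
    (hsparse : (fun t => t * r t ^ 3) =O[atTop] fun _ => (1 : ℝ)) :
    (fun t => highOverlapBoundOfDensity t R (r t) (κ * t ^ (-α))) =O[atTop]
      fun t => t ^ (4 + α) * r t ^ 9 := by
  refine (isBigO_highOverlapBound (g := fun t => t ^ α) hsparse ?_ ?_ ?_).congr' .rfl ?_
  · exact ((isBigO_refl _ _).const_mul_left (R ^ 3 * (Real.pi * 4 / 3))).congr_left fun t => by ring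
  · exact ((isBigO_refl _ _).const_mul_left (Real.pi * 4 / 3)).congr_left fun t => by ring
  · refine ((isBigO_refl _ _).const_mul_left (192 / κ)).congr' ?_ .rfl
    filter_upwards [eventually_gt_atTop 0] with t ht
    have := (Real.rpow_pos_of_pos ht α).ne'
    rw [Real.rpow_neg ht.le]
    field_simp
    ring
  · filter_upwards [eventually_gt_atTop 0] with t ht
    rw [Real.rpow_add ht, ← Real.rpow_natCast t 4, Nat.cast_ofNat]

lemma isBigO_rpow_mul_of_le {p q : ℝ} (hpq : p ≤ q) (f : ℝ → ℝ) :
    (fun t => t ^ p * f t) =O[atTop] fun t => t ^ q * f t := by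
  refine (IsBigO.of_norm_eventuallyLE ?_).mul (isBigO_refl f atTop)
  filter_upwards [eventually_ge_atTop 1] with t ht
  rw [Real.norm_of_nonneg (by positivity)]
  exact Real.rpow_le_rpow_of_exponent_le ht hpq

end Asymptotics

section Sphere

variable {x y : Sphere2}

lemma dSphere_neg_right (x y : Sphere2) : dSphere x (-y) = Real.pi - dSphere x y :=
  InnerProductGeometry.angle_neg_right _ _

lemma mul_le_sin_of_le_of_le_pi_sub {a φ : ℝ} (ha : 0 ≤ a) (h : a ≤ φ) (h' : a ≤ Real.pi - φ) :
    2 / Real.pi * a ≤ Real.sin φ := by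
  rcases le_total φ (Real.pi / 2) with hφ | hφ
  · exact (mul_le_mul_of_nonneg_left h (by positivity)).trans
      (Real.mul_le_sin (ha.trans h) hφ)
  · rw [← Real.sin_pi_sub]
    exact (mul_le_mul_of_nonneg_left h' (by positivity)).trans
      (Real.mul_le_sin (ha.trans h') (by linarith))

lemma dSphere_le_dSphere_neg (hx : x ∈ spherePos) (hy : y ∈ spherePos) :
    dSphere x y ≤ dSphere x (-y) := by
  have hinner : 0 ≤ inner ℝ (x : E3) (y : E3) := by
    rw [PiLp.inner_apply]
    exact Finset.sum_nonneg fun i _ => mul_nonneg (hy i).le (hx i).le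
  have hangle : dSphere x y ≤ Real.pi / 2 := Real.arccos_le_pi_div_two.2 (by positivity)
  rw [dSphere_neg_right]
  linarith

end Sphere

theorem mainTheorem4_general {W : Set E3} (hW : Bornology.IsBounded W) {r : ℝ → ℝ}
    (hr : ∀ t : ℝ, 0 < t → 0 < r t)
    (hsparse : (fun t : ℝ => t * r t ^ 3) =O[atTop] fun _ => (1 : ℝ)) (α : ℝ) :
    ∃ c₁ c₂ : ℝ → ℝ,
      c₁ =O[atTop] (fun t : ℝ => t ^ 6 * r t ^ 13) ∧
      c₂ =O[atTop] (fun t : ℝ => t ^ (4 + α) * r t ^ 9) ∧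
      ∀ (Ω : Type*) [MeasurableSpace Ω] (P : Measure Ω) [IsProbabilityMeasure P]
        (t : ℝ) (_ : 0 < t) (Λ : Measure E3) (_ : Λ ≤ ENNReal.ofReal t • volume.restrict W)
        (η : Ω → Set E3) (_ : IsPoissonProcess P Λ η)
        (θ : Sphere2 → Matrix.specialOrthogonalGroup (Fin 3) ℝ)
        (_ : ∀ x : Sphere2, rotate (θ x) (EuclideanSpace.single 2 1) = (x : E3)) (x y : Sphere2),
        dSphere x y > t ^ (-α) → dSphere x (-y) > t ^ (-α) →
          MemLp (fun ω => crossingCount (η ω) (r t) (plane θ x) (plane θ x)) 2 P ∧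
          MemLp (fun ω => crossingCount (η ω) (r t) (plane θ y) (plane θ y)) 2 P ∧
          cov[fun ω => crossingCount (η ω) (r t) (plane θ x) (plane θ x),
            fun ω => crossingCount (η ω) (r t) (plane θ y) (plane θ y); P] < c₁ t + c₂ t := by
  obtain ⟨R, hR, hWR⟩ := hW.subset_closedBall_lt 0 0
  refine ⟨fun t => 11 * lowOverlapBoundOfDensity t R (r t),
    fun t => 11 * highOverlapBoundOfDensity t R (r t) (2 / Real.pi * t ^ (-α)),
    (isBigO_lowOverlapBoundOfDensity R hsparse).const_mul_left _,
    (isBigO_highOverlapBoundOfDensity R (by positivity) α hsparse).const_mul_left _, ?_⟩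
  intro Ω _ P _ t ht Λ hΛ η h θ hθ x y hxy hxy'
  replace hΛ : Λ ≤ ENNReal.ofReal t • volume.restrict (Metric.closedBall 0 R) :=
    hΛ.trans (by gcongr)
  have := isFiniteMeasure_of_le_smul_volume hΛ
  have := nullSingletonClass_of_le_smul_volume hΛ
  have hδ : 0 < 2 / Real.pi * t ^ (-α) := by positivity
  rw [dSphere_neg_right] at hxy'
  have hsin := mul_le_sin_of_le_of_le_pi_sub (Real.rpow_nonneg ht.le _) hxy.le hxy'.le
  refine ⟨h.memLp_crossingCount _ _, h.memLp_crossingCount _ _, ?_⟩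
  rw [plane_eq_orthogonal (hθ x), plane_eq_orthogonal (hθ y)]
  refine (h.covariance_crossingCount_orthogonal_le hΛ ht.le hR.le (hr t ht).le
    (norm_eq_of_mem_sphere x) (norm_eq_of_mem_sphere y) hδ hsin).trans_lt ?_
  linarith [lowOverlapBoundOfDensity_nonneg ht.le hR.le (hr t ht).le,
    highOverlapBoundOfDensity_pos ht hR (hr t ht) hδ]

theorem mainTheorem4
    (z : E3) (R : ℝ) (hW : volume (Metric.closedBall z R) = 1)
    (r : ℝ → ℝ) (hr : ∀ t : ℝ, 0 < t → 0 < r t)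
    (hsparse : Tendsto (fun t : ℝ => t * r t ^ 3) atTop (𝓝 0))
    (α : ℝ) (hα : 0 < α) :
    ∃ c₁ c₂ : ℝ → ℝ,
      c₁ =O[atTop] (fun t : ℝ => t ^ 6 * r t ^ 13) ∧
      c₂ =O[atTop] (fun t : ℝ => t ^ (4 + 3 * α) * r t ^ 9) ∧
      ∀ (Ω : Type*) [MeasurableSpace Ω] (P : Measure Ω) [IsProbabilityMeasure P]
        (t : ℝ) (_ : 0 < t) (η : Ω → Set E3)
        (_ : IsPoissonProcess P (ENNReal.ofReal t • volume.restrict (Metric.closedBall z R)) η)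
        (θ : Sphere2 → Matrix.specialOrthogonalGroup (Fin 3) ℝ)
        (_ : ∀ x : Sphere2, rotate (θ x) (EuclideanSpace.single 2 1) = (x : E3)),
        ∀ x ∈ spherePos, ∀ y ∈ spherePos, dSphere x y > t ^ (-α) →
          MemLp (fun ω => crossingCount (η ω) (r t) (plane θ x) (plane θ x)) 2 P ∧
          MemLp (fun ω => crossingCount (η ω) (r t) (plane θ y) (plane θ y)) 2 P ∧
          cov[fun ω => crossingCount (η ω) (r t) (plane θ x) (plane θ x),
            fun ω => crossingCount (η ω) (r t) (plane θ y) (plane θ y); P] < c₁ t + c₂ t := by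
  obtain ⟨c₁, c₂, hc₁, hc₂, hcov⟩ := mainTheorem4_general (Metric.isBounded_closedBall (x := z)) hr
    (hsparse.isBigO_one ℝ) α
  refine ⟨c₁, c₂, hc₁, hc₂.trans (isBigO_rpow_mul_of_le (by linarith) _), ?_⟩
  intro Ω _ P _ t ht η h θ hθ x hx y hy hxy
  exact hcov Ω P t ht _ le_rfl η h θ hθ x y hxy (hxy.trans_le (dSphere_le_dSphere_neg hx hy))
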